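/- Let $q=e^{2\pi i z}$, $f'=\frac1{2\pi i}\frac{df}{dz}$, let $E_2,E_4,E_6$ be the normalised Eisenstein series for $\mathrm{SL}_2(\mathbb Z)$, $\Delta=\frac1{1728}(E_4^3-E_6^2)$ and $j=E_4^3/\Delta$. Put $\omega_0=1$, $\omega_1=E_4^2E_6/\Delta$, $\omega_2=E_4$, $\omega_3=E_6$, $\omega_4=E_4^2$, $\omega_5=E_4E_6$, $\omega_6=\Delta$, $\omega_7=E_4^2E_6$. Let the functions $f_w$ on the upper half-plane ($w\equiv0\pmod 4$, $w\ge8$) be given by $$f_8=E_4^2-2E_2E_6+E_2^2E_4,\qquad f_{12}=\tfrac1{6000}\left(E_6^2-2E_2E_4E_6+E_2^2E_4^2\right),$$ $$f_{16}=\tfrac1{2540160000}\left(-25E_4^4+49E_4E_6^2-48E_2E_4^2E_6+E_2^2(49E_4^3-25E_6^2)\right)$$ and, for $w\ge16$, $w\equiv0\pmod 4$, by the recurrence $$f_{w+4}=\frac{200(w-8)(w-9)(w^2-15w+38)E_4f_w-\frac58(w-8)(w-12)E_4^2f_{w-4}+\Delta f_{w-8}}{16000(w+2)(w-3)(w-5)(w-9)(w-10)(w-11)}.$$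 Then $$f_8=\tfrac{36}5E_4'',\qquad f_{12}=\tfrac1{3000}(E_4^2)''-\tfrac4{25}\Delta,\qquad f_{16}=\tfrac{1}{2751840000}(49E_4^3-25E_6^2)''-\tfrac1{45500}\Delta E_4,$$ and for every $w\equiv0\pmod4$, $w\ge8$, written as $w=12n+2k+4$ with integers $n\ge0$ and $0\le k\le5$ (so $k\in\{0,2,4\}$), the following hold. 1. $f_w$ is a quasimodular form of weight $w$ and depth $2$, that is, $f_w=F_0+E_2F_1+E_2^2F_2$ with holomorphic modular forms $F_\ell$ of weight $w-2\ell$ for $\mathrm{SL}_2(\mathbb Z)$ and $F_2\ne0$. 2. $f=f_w$ satisfies the third-order differential equation $$f'''-\frac w4E_2f''+\left(\frac{w-4}4E_4+\frac{w(w-1)}4E_2'\right)f'-\left(\frac{(w-2)(w-4)}{16}E_4'+\frac{w(w-1)(w-2)}{24}E_2''\right)f=0.$$ 3. There is exactly one triple of polynomials $P,Q,R\in\mathbb C[X]$ with $$f_w=\Delta^n\left(\omega_{k+2}P(j)-2\omega_{k+1}E_2Q(j)+\omega_kE_2^2R(j)\right);$$ the degrees $(\deg P,\deg Q,\deg R)$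 are $(n,n-1,n)$ for $k=0$, $(n,n,n)$ for $k=2$ and $(n+1,n,n)$ for $k=4$. 4. With these polynomials set $g_w=\Delta^n\left(\omega_{k+1}Q(j)-\omega_kE_2R(j)\right)$ and $h_w=\Delta^n\omega_kR(j)$. Then $f_w$, $g_w$ and $h_w$ have the exact orders $q^{w/4-1}$, $q$ and $1$ at $i\infty$; that is, $f_w/q^{w/4-1}$, $g_w/q$ and $h_w$ have finite nonzero limits as $\operatorname{Im}z\to\infty$. -/

import Mathlib

open UpperHalfPlane hiding I
open Filter Topology
open scoped MatrixGroups Polynomial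

namespace QuasimodularRecurrence

noncomputable section

/-- The Eisenstein series `E₂ = 1 - 24 ∑ σ₁(n) qⁿ`. -/
abbrev E2 : ℍ → ℂ := EisensteinSeries.E2

/-- The Eisenstein series `E₄ = 1 + 240 ∑ σ₃(n) qⁿ`. -/
abbrev E4 : ℍ → ℂ := ⇑ModularForm.E₄

/-- The Eisenstein series `E₆ = 1 - 504 ∑ σ₅(n) qⁿ`. -/
abbrev E6 : ℍ → ℂ := ⇑ModularForm.E₆

/-- The modular discriminant `Δ = q ∏ (1 - qⁿ)²⁴ = (E₄³ - E₆²) / 1728`. -/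
abbrev Del : ℍ → ℂ := ModularForm.discriminant

/-- The derivative `f' = (2πi)⁻¹ df/dz = q df/dq`. -/
abbrev dq : (ℍ → ℂ) → ℍ → ℂ := Derivative.normalizedDerivOfComplex

/-- Klein's modular function `j = E₄³ / Δ`. -/
def klein (z : ℍ) : ℂ := E4 z ^ 3 / Del z

/-- The (weakly holomorphic) modular forms `ω_m` of weight `2m`, `m = 0, …, 7`. -/
def omega : ℕ → ℍ → ℂ
  | 0 => 1
  | 1 => E4 ^ 2 * E6 / Del
  | 2 => E4
  | 3 => E6
  | 4 => E4 ^ 2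
  | 5 => E4 * E6
  | 6 => Del
  | 7 => E4 ^ 2 * E6
  | _ => 0

/-- The degree of the polynomial `P` with parameters `n` and `k`, `0 ≤ k ≤ 5`. -/
def degP (n k : ℕ) : ℕ := if k = 4 then n + 1 else n

/-- The degree of `Q`. -/
def degQ (n k : ℕ) : ℕ := if k = 0 then n - 1 else if k = 5 then n + 1 else n

/-- The degree of `R`. -/
def degR (n k : ℕ) : ℕ := if k = 1 then n - 1 else n

/-- `f = Δⁿ (ω_{k+2} P(j) - 2 ω_{k+1} E₂ Q(j) + ω_k E₂² R(j))`, of weight `12n + 2k + 4`. -/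
def fForm (n k : ℕ) (P Q R : ℂ[X]) (z : ℍ) : ℂ :=
  Del z ^ n * (omega (k + 2) z * P.eval (klein z)
    - 2 * omega (k + 1) z * E2 z * Q.eval (klein z)
    + omega k z * E2 z ^ 2 * R.eval (klein z))

/-- `g = Δⁿ (ω_{k+1} Q(j) - ω_k E₂ R(j))`. -/
def gForm (n k : ℕ) (Q R : ℂ[X]) (z : ℍ) : ℂ :=
  Del z ^ n * (omega (k + 1) z * Q.eval (klein z) - omega k z * E2 z * R.eval (klein z))

/-- `h = Δⁿ ω_k R(j)`. -/
def hForm (n k : ℕ) (R : ℂ[X]) (z : ℍ) : ℂ :=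
  Del z ^ n * (omega k z * R.eval (klein z))

/-- `f` is a (holomorphic) quasimodular form of weight `w` and depth `s` for `SL(2, ℤ)`:
`f = ∑_{ℓ ≤ s} E₂^ℓ F_ℓ` with modular forms `F_ℓ` of weight `w - 2ℓ` and `F_s ≠ 0`. -/
def IsQuasimodular (w : ℤ) (s : ℕ) (f : ℍ → ℂ) : Prop :=
  ∃ F : (l : ℕ) → ModularForm 𝒮ℒ (w - 2 * (l : ℤ)), F s ≠ 0 ∧
    ∀ z : ℍ, f z = ∑ l ∈ Finset.range (s + 1), E2 z ^ l * F l z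

/-- `f` has exact order `q^m` at `i∞`: `f / q^m` has a nonzero limit as `Im z → ∞`,
where `q = exp (2πiz)`. -/
def HasExactOrder (f : ℍ → ℂ) (m : ℕ) : Prop :=
  ∃ c : ℂ, c ≠ 0 ∧
    Tendsto (fun z : ℍ => f z / Complex.exp (2 * Real.pi * Complex.I * z) ^ m) atImInfty (𝓝 c)

/-- The differential equation
`f''' - w/4 E₂ f'' + ((w-4)/4 E₄ + w(w-1)/4 E₂') f'
  - ((w-2)(w-4)/16 E₄' + w(w-1)(w-2)/24 E₂'') f = 0`. -/
def SolvesODE (w : ℂ) (f : ℍ → ℂ) : Prop :=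
  ∀ z : ℍ,
    dq (dq (dq f)) z - w / 4 * E2 z * dq (dq f) z
      + ((w - 4) / 4 * E4 z + w * (w - 1) / 4 * dq E2 z) * dq f z
      - ((w - 2) * (w - 4) / 16 * dq E4 z
          + w * (w - 1) * (w - 2) / 24 * dq (dq E2) z) * f z = 0

/-- The sequence `(f_w)`, `w ≡ 0 (mod 4)`, `w ≥ 8`, is given by the initial elements
`f_8`, `f_12`, `f_16` and the three-term recurrence. Indices not of this kind are irrelevant. -/
structure IsRecurrenceSequence (f : ℕ → ℍ → ℂ) : Prop where
  init8 : ∀ z, f 8 z = E4 z ^ 2 - 2 * E2 z * E6 z + E2 z ^ 2 * E4 z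
  init12 : ∀ z, f 12 z =
    1 / 6000 * (E6 z ^ 2 - 2 * E2 z * E4 z * E6 z + E2 z ^ 2 * E4 z ^ 2)
  init16 : ∀ z, f 16 z =
    1 / 2540160000 * (-25 * E4 z ^ 4 + 49 * E4 z * E6 z ^ 2 - 48 * E2 z * E4 z ^ 2 * E6 z
      + E2 z ^ 2 * (49 * E4 z ^ 3 - 25 * E6 z ^ 2))
  recurrence : ∀ w : ℕ, 16 ≤ w → 4 ∣ w → ∀ z, f (w + 4) z =
    1 / (16000 * ((w : ℂ) + 2) * (w - 3) * (w - 5) * (w - 9) * (w - 10) * (w - 11)) *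
      (200 * ((w : ℂ) - 8) * (w - 9) * (w ^ 2 - 15 * w + 38) * E4 z * f w z
        - 5 / 8 * ((w : ℂ) - 8) * (w - 12) * E4 z ^ 2 * f (w - 4) z
        + Del z * f (w - 8) z)

end

end QuasimodularRecurrence

open UpperHalfPlane hiding I
open Filter Topology
open scoped MatrixGroups Polynomial

namespace QuasimodularRecurrence

open scoped Manifold ModularForm
open Derivative

noncomputable section

/-! Write ϑ for the Serre derivative. In terms of ϑ the differential equation becomes
`SolvesSerreODE`, a third-order equation over ℂ[E₄, E₆] without ϑ² term and with exponents 0, 1, w/4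
- 1 at i∞. The operator `raiseOp w`, a multiple of ϑ² - (w-5)(w-6)/36 · E₄, maps solutions for w to
solutions for w + 4 (`solvesSerreODE_raiseOp`), and a second-order operator inverts it up to Δ
(`Del_mul_eq_raiseOp`). Eliminating between three consecutive functions yields exactly the given
recurrence (`raiseOp_recurrence`), so every f_{w+4} is `raiseOp w` of f_w. This gives the
differential equation. It also gives the order of f_w: raising kills the term q^{w/4-1}, and the
inverse shows that it gains only one power of q.

The recurrence is linear over functions, so the coefficients of 1, -2E₂ and E₂² in f_w satisfy it
separately (`coeffA`, `coeffB`, `coeffC`). They are therefore modular forms. Since Δ vanishes at i∞,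
constant terms (and coefficients of q, for forms vanishing at i∞) obey a shorter recurrence with
scalar coefficients, solved by an explicit nonvanishing product. This yields the orders of h_w and
g_w. The same product is the leading coefficient of P, Q and R, because multiplication by Δ does not
reach the top degree in j. This settles the degrees.

The polynomials are unique because 1, E₂, E₂² are independent over functions with modular
transformation behaviour (`eq_zero_of_quadratic_E2`), and because j is unbounded near i∞. -/

/-- The local parameter `q = exp (2πiz)` at `i∞`. -/
def qpar (z : ℍ) : ℂ := Complex.exp (2 * Real.pi * Complex.I * z)

theorem qpar_ne_zero (z : ℍ) : qpar z ≠ 0 := Complex.exp_ne_zero _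

theorem qpar_eq_qParam (z : ℍ) : qpar z = Function.Periodic.qParam 1 z := by
  simp [qpar, Function.Periodic.qParam]

theorem qpar_mem_ball (z : ℍ) : qpar z ∈ Metric.ball (0 : ℂ) 1 := by
  rw [qpar_eq_qParam, mem_ball_zero_iff]
  exact Function.Periodic.norm_qParam_lt_one one_pos z.im_pos

theorem tendsto_qpar : Tendsto qpar atImInfty (𝓝 0) := by
  have := qParam_tendsto_atImInfty (h := 1) one_pos
  exact this.congr fun z => (qpar_eq_qParam z).symm

/-! ### Expansions in q at i∞ -/

/-- `f = qᵐ (c + O(q))`, where the second factor is a holomorphic function of `q` on the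
unit disc. -/
def HasLeadingCoeff (f : ℍ → ℂ) (m : ℕ) (c : ℂ) : Prop :=
  ∃ ψ : ℂ → ℂ, DifferentiableOn ℂ ψ (Metric.ball 0 1) ∧ ψ 0 = c ∧
    ∀ z : ℍ, f z = qpar z ^ m * ψ (qpar z)

namespace HasLeadingCoeff

variable {f g : ℍ → ℂ} {m n : ℕ} {c d : ℂ}

theorem congr (h : HasLeadingCoeff f m c) (hfg : ∀ z, g z = f z) (hc : d = c)
    (hm : n = m := by omega) : HasLeadingCoeff g n d := by
  subst hm
  obtain ⟨ψ, h1, h2, h3⟩ := h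
  exact ⟨ψ, h1, h2.trans hc.symm, fun z => (hfg z).trans (h3 z)⟩

theorem add (hf : HasLeadingCoeff f m c) (hg : HasLeadingCoeff g m d) :
    HasLeadingCoeff (fun z => f z + g z) m (c + d) := by
  obtain ⟨ψ, h1, h2, h3⟩ := hf
  obtain ⟨φ, k1, k2, k3⟩ := hg
  exact ⟨fun q => ψ q + φ q, h1.add k1, by simp [h2, k2], fun z => by dsimp only; rw [h3, k3]; ring⟩

theorem mul (hf : HasLeadingCoeff f m c) (hg : HasLeadingCoeff g n d) :
    HasLeadingCoeff (fun z => f z * g z) (m + n) (c * d) := by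
  obtain ⟨ψ, h1, h2, h3⟩ := hf
  obtain ⟨φ, k1, k2, k3⟩ := hg
  exact ⟨fun q => ψ q * φ q, h1.mul k1, by simp [h2, k2], fun z => by dsimp only; rw [h3, k3]; ring⟩

theorem const_mul (a : ℂ) (hf : HasLeadingCoeff f m c) :
    HasLeadingCoeff (fun z => a * f z) m (a * c) := by
  obtain ⟨ψ, h1, h2, h3⟩ := hf
  exact ⟨fun q => a * ψ q, h1.const_mul a, by simp [h2], fun z => by dsimp only; rw [h3]; ring⟩

theorem const (a : ℂ) : HasLeadingCoeff (fun _ => a) 0 a :=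
  ⟨fun _ => a, differentiableOn_const _, rfl, fun z => by simp⟩

theorem sub (hf : HasLeadingCoeff f m c) (hg : HasLeadingCoeff g m d) :
    HasLeadingCoeff (fun z => f z - g z) m (c - d) :=
  (hf.add (hg.const_mul (-1))).congr (fun z => by ring) (by ring)

theorem pow_zero_order (hf : HasLeadingCoeff f 0 c) (k : ℕ) :
    HasLeadingCoeff (fun z => f z ^ k) 0 (c ^ k) := by
  induction k with
  | zero => exact (const 1).congr (fun z => by simp) (by simp)
  | succ k ih => exact (ih.mul hf).congr (fun z => pow_succ _ _) (pow_succ _ _)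

/-- A form of order at least `m + 1` has vanishing coefficient of `qᵐ`. -/
theorem lower (hf : HasLeadingCoeff f (m + 1) c) : HasLeadingCoeff f m 0 := by
  obtain ⟨ψ, h1, h2, h3⟩ := hf
  exact ⟨fun q => q * ψ q, differentiableOn_id.mul h1, by simp, fun z => by rw [h3]; ring⟩

/-- If the coefficient of `qᵐ` vanishes, another power of `q` can be split off. -/
theorem raise (hf : HasLeadingCoeff f m 0) : ∃ d, HasLeadingCoeff f (m + 1) d := by
  obtain ⟨ψ, h1, h2, h3⟩ := hf
  refine ⟨_, dslope ψ 0, (Complex.differentiableOn_dslope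
    (Metric.ball_mem_nhds 0 one_pos)).2 h1, rfl, fun z => ?_⟩
  have := sub_smul_dslope ψ 0 (qpar z)
  rw [h2] at this
  rw [h3]
  simp only [sub_zero, smul_eq_mul] at this
  rw [← this]; ring

theorem tendsto (hf : HasLeadingCoeff f m c) :
    Tendsto (fun z => f z / qpar z ^ m) atImInfty (𝓝 c) := by
  obtain ⟨ψ, h1, h2, h3⟩ := hf
  have hc : ContinuousAt ψ 0 := (h1.differentiableAt (Metric.ball_mem_nhds 0 one_pos)).continuousAt
  have := hc.tendsto.comp tendsto_qpar
  rw [h2] at this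
  refine this.congr fun z => ?_
  rw [h3, mul_div_cancel_left₀ _ (pow_ne_zero _ (qpar_ne_zero z))]
  rfl

theorem tendsto_zero_order (hf : HasLeadingCoeff f 0 c) : Tendsto f atImInfty (𝓝 c) := by
  simpa using hf.tendsto

theorem unique (hf : HasLeadingCoeff f m c) (hg : HasLeadingCoeff f m d) : c = d :=
  tendsto_nhds_unique hf.tendsto hg.tendsto

theorem hasExactOrder (hf : HasLeadingCoeff f m c) (hc : c ≠ 0) : HasExactOrder f m :=
  ⟨c, hc, hf.tendsto⟩

/-- The operator q d/dq sends qᵐψ to qᵐ(mψ + qψ'), which again has a holomorphic second factor.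
Hence differentiation keeps the exponent and multiplies the leading coefficient by m. -/
theorem hasDerivAt (hf : HasLeadingCoeff f m c) :
    ∃ ψ : ℂ → ℂ, DifferentiableOn ℂ ψ (Metric.ball 0 1) ∧ ψ 0 = m * c ∧
      ∀ z : ℍ, HasDerivAt (f ∘ ofComplex)
        (2 * Real.pi * Complex.I * (qpar z ^ m * ψ (qpar z))) (z : ℂ) := by
  obtain ⟨ψ, h1, h2, h3⟩ := hf
  refine ⟨fun q => m * ψ q + q * deriv ψ q,
    (h1.const_mul _).add (differentiableOn_id.mul (h1.deriv Metric.isOpen_ball)),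
    by simp [h2], fun z => ?_⟩
  have hq : HasDerivAt (fun w : ℂ => Complex.exp (2 * Real.pi * Complex.I * w))
      (qpar z * (2 * Real.pi * Complex.I)) z := by
    have := ((hasDerivAt_id (z : ℂ)).const_mul (2 * Real.pi * Complex.I)).cexp
    simpa [qpar] using this
  have hψ : HasDerivAt ψ (deriv ψ (qpar z)) (qpar z) :=
    (h1.differentiableAt (Metric.isOpen_ball.mem_nhds (qpar_mem_ball z))).hasDerivAt
  have hcomp := (hq.pow m).mul (HasDerivAt.comp (z : ℂ) hψ hq)
  have heq : (f ∘ ofComplex) =ᶠ[𝓝 (z : ℂ)]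
      ((fun w : ℂ => Complex.exp (2 * Real.pi * Complex.I * w)) ^ m *
        (ψ ∘ fun w : ℂ => Complex.exp (2 * Real.pi * Complex.I * w))) := by
    filter_upwards [isOpen_upperHalfPlaneSet.mem_nhds z.im_pos] with w hw
    simp [ofComplex_apply_of_im_pos hw, h3, qpar]
  refine (hcomp.congr_of_eventuallyEq heq).congr_deriv ?_
  rcases m with _ | m
  · simp [qpar]; ring
  · simp [qpar]; ring

theorem mdiff (hf : HasLeadingCoeff f m c) : MDiff f := fun z => by
  obtain ⟨ψ, -, -, h⟩ := hf.hasDerivAt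
  exact mdifferentiableAt_iff.2 (h z).differentiableAt

theorem normalizedDeriv (hf : HasLeadingCoeff f m c) : HasLeadingCoeff (dq f) m (m * c) := by
  obtain ⟨ψ, h1, h2, h3⟩ := hf.hasDerivAt
  refine ⟨ψ, h1, h2, fun z => ?_⟩
  have h0 : (2 * Real.pi * Complex.I : ℂ) ≠ 0 := Complex.two_pi_I_ne_zero
  change (2 * Real.pi * Complex.I : ℂ)⁻¹ * deriv (f ∘ ofComplex) z = _
  rw [(h3 z).deriv, inv_mul_cancel_left₀ h0]

end HasLeadingCoeff

theorem hasLeadingCoeff_cuspFunction {f : ℍ → ℂ}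
    (hper : Function.Periodic (f ∘ ofComplex) ((1 : ℝ) : ℂ)) (hf : MDiff f)
    (hb : IsBoundedAtImInfty f) : HasLeadingCoeff f 0 (cuspFunction 1 f 0) :=
  ⟨cuspFunction 1 f, differentiableOn_cuspFunction_ball one_pos hper hf hb, rfl, fun z => by
    rw [pow_zero, one_mul, qpar_eq_qParam, eq_cuspFunction z one_ne_zero hper]⟩

theorem hasLeadingCoeff_modularForm {k : ℤ} (f : ModularForm 𝒮ℒ k) :
    HasLeadingCoeff f 0 ((qExpansion 1 f).coeff 0) := by
  refine (hasLeadingCoeff_cuspFunction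
    (SlashInvariantFormClass.periodic_comp_ofComplex f one_mem_strictPeriods_SL)
    (ModularFormClass.holo f) (ModularFormClass.bdd_at_infty f)).congr (fun _ => rfl) ?_
  simp [qExpansion_coeff]

theorem hasLeadingCoeff_E4 : HasLeadingCoeff E4 0 1 :=
  (hasLeadingCoeff_modularForm ModularForm.E₄).congr (fun _ => rfl)
    (EisensteinSeries.E_qExpansion_coeff_zero _ ⟨2, rfl⟩).symm

theorem hasLeadingCoeff_E6 : HasLeadingCoeff E6 0 1 :=
  (hasLeadingCoeff_modularForm ModularForm.E₆).congr (fun _ => rfl)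
    (EisensteinSeries.E_qExpansion_coeff_zero _ ⟨3, rfl⟩).symm

/-- E₂ is not modular, so its periodicity is read off from its q-series. -/
theorem periodic_E2 : Function.Periodic (E2 ∘ ofComplex) ((1 : ℝ) : ℂ) := by
  intro w
  by_cases hw : 0 < w.im
  · have hw' : 0 < (w + ((1 : ℝ) : ℂ)).im := by simpa using hw
    simp only [Function.comp_apply, ofComplex_apply_of_im_pos hw, ofComplex_apply_of_im_pos hw']
    have h1 := EisensteinSeries.hasSum_qExpansion_E2 (z := ⟨w, hw⟩)
    have h2 := EisensteinSeries.hasSum_qExpansion_E2 (z := ⟨w + ((1 : ℝ) : ℂ), hw'⟩)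
    refine h2.unique ?_
    convert h1 using 4
    change Complex.exp (2 * Real.pi * Complex.I * (w + ((1 : ℝ) : ℂ))) =
      Complex.exp (2 * Real.pi * Complex.I * w)
    rw [Complex.ofReal_one, mul_add, mul_one, Complex.exp_periodic]
  -- Outside the upper half-plane `ofComplex` takes one fixed default value.
  · have hw' : (w + ((1 : ℝ) : ℂ)).im ≤ 0 := by simpa using hw
    simp only [Function.comp_apply, ofComplex_apply_of_im_nonpos hw',
      ofComplex_apply_of_im_nonpos (not_lt.1 hw)]

theorem hasLeadingCoeff_E2 : HasLeadingCoeff E2 0 1 := by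
  refine (hasLeadingCoeff_cuspFunction periodic_E2 E2_mdifferentiable
    EisensteinSeries.isBoundedAtImInfty_E2).congr (fun _ => rfl) ?_
  have han := analyticAt_cuspFunction_zero one_pos periodic_E2
    E2_mdifferentiable EisensteinSeries.isBoundedAtImInfty_E2
  have h := hasFPowerSeriesOnBall_cuspFunction one_pos han (fun τ => by
    simpa only [Function.Periodic.qParam, Complex.ofReal_one, div_one] using
      EisensteinSeries.hasSum_qExpansion_E2 (z := τ))
  have := h.hasFPowerSeriesAt.coeff_zero ![]
  simpa using this

theorem hasLeadingCoeff_Del : HasLeadingCoeff Del 1 1 := by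
  refine ⟨fun q => ∏' i : ℕ, (1 - q ^ (i + 1)) ^ 24, ModularForm.differentiableOn_tprod_one_sub_pow_pow 24,
    by simp, fun z => ?_⟩
  have h := ModularForm.discriminant_cuspFunction_eqOn (qpar_mem_ball z)
  rw [pow_one]
  refine Eq.trans ?_ h
  rw [qpar_eq_qParam]
  exact (SlashInvariantFormClass.eq_cuspFunction CuspForm.discriminant z
    one_mem_strictPeriods_SL one_ne_zero).symm

theorem Del_eq (z : ℍ) : Del z = (E4 z ^ 3 - E6 z ^ 2) / 1728 :=
  ModularForm.discriminant_eq_E₄_cube_sub_E₆_sq z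

/-! ### Modular forms of level one and Ramanujan's identities -/

/-- `f` is the underlying function of a modular form of weight `k` and level one. -/
def IsModular (k : ℤ) (f : ℍ → ℂ) : Prop := ∃ F : ModularForm 𝒮ℒ k, ∀ z, F z = f z

namespace IsModular

variable {k l : ℤ} {f g : ℍ → ℂ}

theorem congr (h : IsModular k f) (hkl : l = k) (hfg : ∀ z, g z = f z) : IsModular l g := by
  subst hkl
  obtain ⟨F, hF⟩ := h
  exact ⟨F, fun z => (hF z).trans (hfg z).symm⟩

theorem add (hf : IsModular k f) (hg : IsModular k g) : IsModular k (fun z => f z + g z) := by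
  obtain ⟨F, hF⟩ := hf
  obtain ⟨G, hG⟩ := hg
  exact ⟨F + G, fun z => by simp [hF, hG]⟩

theorem const_mul (a : ℂ) (hf : IsModular k f) : IsModular k (fun z => a * f z) := by
  obtain ⟨F, hF⟩ := hf
  exact ⟨a • F, fun z => by simp [hF]⟩

theorem sub (hf : IsModular k f) (hg : IsModular k g) : IsModular k (fun z => f z - g z) :=
  (hf.add (hg.const_mul (-1))).congr rfl fun z => by ring

theorem mul (hf : IsModular k f) (hg : IsModular l g) :
    IsModular (k + l) (fun z => f z * g z) := by
  obtain ⟨F, hF⟩ := hf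
  obtain ⟨G, hG⟩ := hg
  exact ⟨F.mul G, fun z => by simp [hF, hG]⟩

theorem E4 : IsModular 4 E4 := ⟨ModularForm.E₄, fun _ => rfl⟩

theorem E6 : IsModular 6 E6 := ⟨ModularForm.E₆, fun _ => rfl⟩

theorem Del : IsModular 12 Del := ⟨(CuspForm.discriminant : ModularForm 𝒮ℒ 12), fun _ => rfl⟩

/-- All cusps are equivalent under SL(2, ℤ), so for an invariant function boundedness at i∞ is
boundedness at every cusp. -/
theorem of_slash (hf : MDiff f) (hslash : ∀ γ : SL(2, ℤ), f ∣[k] γ = f)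
    (hb : IsBoundedAtImInfty f) : IsModular k f :=
  ⟨{ toFun := f
     slash_action_eq' := fun _ ⟨γ, hγ⟩ => hγ ▸ hslash γ
     holo' := hf
     bdd_at_cusps' := fun {c} hc => by
       rw [Subgroup.IsArithmetic.isCusp_iff_isCusp_SL2Z] at hc
       rw [OnePoint.isBoundedAt_iff_forall_SL2Z hc]
       intro γ _
       rw [hslash γ]
       exact hb }, fun _ => rfl⟩

/-- A modular form of weight less than `12` that vanishes at `i∞` is zero. -/
theorem eq_zero (hf : IsModular k f) (hk : k < 12) (h : HasLeadingCoeff f 0 0) (z : ℍ) :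
    f z = 0 := by
  obtain ⟨F, hF⟩ := hf
  have h0 : (qExpansion 1 F).coeff 0 = 0 :=
    (hasLeadingCoeff_modularForm F).unique (h.congr hF rfl)
  have : F = 0 := by
    refine ModularForm.sturm_bound_levelOne ?_
    -- The Sturm bound is 0 here (`toNat` absorbs negative weights), so a vanishing constant term
    -- suffices.
    have hk' : k.toNat / 12 = 0 := by omega
    rw [hk', Nat.cast_zero, pos_iff_ne_zero, Ne, ← ENat.natCast_zero]
    intro h1
    exact (PowerSeries.order_eq_nat.1 h1).1 h0
  rw [← hF, this]; rfl

end IsModular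

theorem MDiff_E4 : MDiff E4 := hasLeadingCoeff_E4.mdiff
theorem MDiff_E6 : MDiff E6 := hasLeadingCoeff_E6.mdiff
theorem MDiff_E2 : MDiff E2 := hasLeadingCoeff_E2.mdiff

theorem slash_ModularForm {k : ℤ} (F : ModularForm 𝒮ℒ k) (γ : SL(2, ℤ)) :
    (F : ℍ → ℂ) ∣[k] γ = F :=
  SlashInvariantFormClass.slash_action_eq F _ ⟨γ, rfl⟩

/-- The factor m - k/12 is what indicial polynomials are made of. -/
theorem HasLeadingCoeff.serreDerivative {f : ℍ → ℂ} {m : ℕ} {c : ℂ} (hf : HasLeadingCoeff f m c)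
    (k : ℂ) : HasLeadingCoeff (Derivative.serreDerivative k f) m ((m - k / 12) * c) :=
  (hf.normalizedDeriv.sub ((hasLeadingCoeff_E2.mul hf).const_mul (k / 12)
    |>.congr (g := fun z => k * 12⁻¹ * E2 z * f z) (n := m) (d := k / 12 * c)
      (fun z => by ring) (by ring))).congr (fun z => rfl) (by ring)

theorem E2_slash_apply (γ : SL(2, ℤ)) (z : ℍ) :
    (E2 ∣[(2 : ℤ)] γ) z = E2 z + 12 / (2 * Real.pi * Complex.I) * (γ 1 0 / denom γ z) := by
  rw [EisensteinSeries.E2_slash_action]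
  simp only [Pi.sub_apply, Pi.smul_apply, EisensteinSeries.D2, riemannZeta_two, smul_eq_mul]
  have hpi : (Real.pi : ℂ) ≠ 0 := by exact_mod_cast Real.pi_ne_zero
  have hd := denom_ne_zero γ z
  field_simp
  linear_combination (-12 * (γ 1 0 : ℂ)) * Complex.I_sq

theorem hasDerivAt_div_denom (γ : SL(2, ℤ)) (z : ℍ) :
    HasDerivAt ((fun z : ℍ => (γ 1 0 : ℂ) / denom γ z) ∘ ofComplex)
      (-((γ 1 0 : ℂ) / denom γ z) ^ 2) (z : ℂ) := by
  have h := (hasDerivAt_denom_zpow (γ : GL (Fin 2) ℝ) (-1) z).const_mul (γ 1 0 : ℂ)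
  have heq : ((fun z : ℍ => (γ 1 0 : ℂ) / denom γ z) ∘ ofComplex) =ᶠ[𝓝 (z : ℂ)]
      fun w => (γ 1 0 : ℂ) * denom (γ : GL (Fin 2) ℝ) w ^ (-1 : ℤ) := by
    filter_upwards [isOpen_upperHalfPlaneSet.mem_nhds z.im_pos] with w hw
    simp [ofComplex_apply_of_im_pos hw, div_eq_mul_inv]
  refine (h.congr_of_eventuallyEq heq).congr_deriv ?_
  have hd := denom_ne_zero γ z
  simp [zpow_neg, zpow_ofNat]
  field_simp

/-- Differentiate E₂|γ in two ways: by the general rule for derivatives of slashed functions, and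
from the explicit anomaly, where t = c/(cz+d) satisfies dt/dz = -t². -/
theorem dq_E2_slash_apply (γ : SL(2, ℤ)) (z : ℍ) :
    (dq E2 ∣[(4 : ℤ)] γ) z = dq E2 z
      + 2 / (2 * Real.pi * Complex.I) * (γ 1 0 / denom γ z) * E2 z
      + 12 / (2 * Real.pi * Complex.I) ^ 2 * (γ 1 0 / denom γ z) ^ 2 := by
  have h1 := congrFun (Derivative.normalizedDerivOfComplex_SL_slash (k := 2) MDiff_E2 (γ := γ)) z
  have hτ : (2 * Real.pi * Complex.I : ℂ) ≠ 0 := Complex.two_pi_I_ne_zero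
  have hfun : (E2 ∣[(2 : ℤ)] γ) =
      E2 + fun z : ℍ => 12 / (2 * Real.pi * Complex.I) * (γ 1 0 / denom γ z) :=
    funext fun z => E2_slash_apply γ z
  have h2 : dq (E2 ∣[(2 : ℤ)] γ) z = dq E2 z -
      12 / (2 * Real.pi * Complex.I) ^ 2 * (γ 1 0 / denom γ z) ^ 2 := by
    rw [hfun]
    have hd := (mdifferentiableAt_iff.1 (MDiff_E2 z)).hasDerivAt.add
      ((hasDerivAt_div_denom γ z).const_mul (12 / (2 * Real.pi * Complex.I)))
    change (2 * Real.pi * Complex.I : ℂ)⁻¹ * deriv _ (z : ℂ) =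
      (2 * Real.pi * Complex.I : ℂ)⁻¹ * deriv (E2 ∘ ofComplex) z - _
    refine (congrArg _ hd.deriv).trans ?_
    field_simp
    ring
  replace h1 := h2.symm.trans h1
  simp only [Pi.sub_apply, E2_slash_apply] at h1
  rw [show (2 + 2 : ℤ) = 4 from rfl, Int.cast_ofNat] at h1
  linear_combination -h1

/-- The anomalies of 12E₂' and E₂² cancel, so their difference is modular of weight 4. Its constant
term is -1, hence adding E₄ gives a form of weight below 12 that vanishes at i∞. -/
theorem dq_E2 (z : ℍ) : dq E2 z = (E2 z ^ 2 - E4 z) / 12 := by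
  have hlead : HasLeadingCoeff (fun z => 12 * dq E2 z - E2 z ^ 2) 0 (-1) :=
    ((hasLeadingCoeff_E2.normalizedDeriv.const_mul 12).sub
      (hasLeadingCoeff_E2.pow_zero_order 2)).congr (fun _ => rfl) (by simp)
  have hmod : IsModular 4 (fun z => 12 * dq E2 z - E2 z ^ 2) := by
    refine IsModular.of_slash hlead.mdiff (fun γ => ?_)
      (hlead.tendsto_zero_order.isBigO_one ℝ)
    ext z
    have h1 := dq_E2_slash_apply γ z
    have h2 := E2_slash_apply γ z
    have hd := denom_ne_zero γ z
    rw [ModularForm.SL_slash_apply] at h1 h2 ⊢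
    have e4 : denom γ z ^ (-4 : ℤ) = (denom γ z ^ (-2 : ℤ)) ^ 2 := by
      rw [← zpow_natCast, ← zpow_mul]; rfl
    rw [e4] at h1 ⊢
    linear_combination 12 * h1 - (E2 (γ • z) * denom γ z ^ (-2 : ℤ) + E2 z
      + 12 / (2 * Real.pi * Complex.I) * (γ 1 0 / denom γ z)) * h2
  have := (hmod.add IsModular.E4).eq_zero (by norm_num)
    ((hlead.add hasLeadingCoeff_E4).congr (fun _ => rfl) (by ring)) z
  linear_combination this / 12

theorem isModular_serreDerivative {k : ℤ} (F : ModularForm 𝒮ℒ k) :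
    IsModular (k + 2) (Derivative.serreDerivative k F) := by
  have h := (hasLeadingCoeff_modularForm F).serreDerivative k
  exact IsModular.of_slash h.mdiff (fun γ => Derivative.serreDerivative_slash_invariant
    (ModularFormClass.holo F) (slash_ModularForm F γ)) (h.tendsto_zero_order.isBigO_one ℝ)

/-- The Serre derivative of E₄ has weight 6 and constant term -1/3, so it is -E₆/3. The identity for
E₆ below arises in the same way. -/
theorem dq_E4 (z : ℍ) : dq E4 z = (E2 z * E4 z - E6 z) / 3 := by
  have h := ((isModular_serreDerivative ModularForm.E₄).congr (l := 6) (by norm_num)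
    fun _ => rfl).add (IsModular.E6.const_mul (1 / 3))
  have := h.eq_zero (by norm_num) (((hasLeadingCoeff_E4.serreDerivative 4).add
    (hasLeadingCoeff_E6.const_mul (1 / 3))).congr
      (fun _ => by norm_num) (by norm_num)) z
  simp only [Derivative.serreDerivative_apply] at this
  push_cast at this
  linear_combination this

theorem dq_E6 (z : ℍ) : dq E6 z = (E2 z * E6 z - E4 z ^ 2) / 2 := by
  have h := ((isModular_serreDerivative ModularForm.E₆).congr (l := 8) (by norm_num)
    fun _ => rfl).add ((IsModular.E4.mul IsModular.E4).const_mul (1 / 2))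
  have := h.eq_zero (by norm_num) (((hasLeadingCoeff_E6.serreDerivative 6).add
    ((hasLeadingCoeff_E4.mul hasLeadingCoeff_E4).const_mul (1 / 2))).congr
      (fun _ => by norm_num) (by norm_num)) z
  simp only [Derivative.serreDerivative_apply] at this
  push_cast at this
  linear_combination this

/-! ### Rules for the derivative and the Serre derivative -/

section Leibniz

variable {f g : ℍ → ℂ} {k l : ℂ}

theorem dq_add (hf : MDiff f) (hg : MDiff g) (z : ℍ) :
    dq (fun z => f z + g z) z = dq f z + dq g z :=
  congrFun (normalizedDerivOfComplex_add f g hf hg) z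

theorem dq_mul (hf : MDiff f) (hg : MDiff g) (z : ℍ) :
    dq (fun z => f z * g z) z = dq f z * g z + f z * dq g z :=
  congrFun (normalizedDerivOfComplex_mul f g hf hg) z

theorem dq_const_mul (c : ℂ) (hf : MDiff f) (z : ℍ) :
    dq (fun z => c * f z) z = c * dq f z :=
  congrFun (normalizedDerivOfComplex_smul c f hf) z

theorem serre_apply (k : ℂ) (f : ℍ → ℂ) (z : ℍ) :
    serreDerivative k f z = dq f z - k / 12 * E2 z * f z := rfl

theorem serre_add (hf : MDiff f) (hg : MDiff g) (z : ℍ) :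
    serreDerivative k (fun z => f z + g z) z = serreDerivative k f z + serreDerivative k g z :=
  congrFun (serreDerivative_add k f g hf hg) z

theorem serre_const_mul (c : ℂ) (hf : MDiff f) (z : ℍ) :
    serreDerivative k (fun z => c * f z) z = c * serreDerivative k f z :=
  congrFun (serreDerivative_smul k c f hf) z

theorem serre_E4_mul (hf : MDiff f) (hk : k = l + 4) (z : ℍ) :
    serreDerivative k (fun z => E4 z * f z) z =
      E4 z * serreDerivative l f z - E6 z / 3 * f z := by
  simp only [serreDerivative_apply, dq_mul MDiff_E4 hf, dq_E4, hk]
  ring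

theorem serre_E6_mul (hf : MDiff f) (hk : k = l + 6) (z : ℍ) :
    serreDerivative k (fun z => E6 z * f z) z =
      E6 z * serreDerivative l f z - E4 z ^ 2 / 2 * f z := by
  simp only [serreDerivative_apply, dq_mul MDiff_E6 hf, dq_E6, hk]
  ring

theorem mdiff_add (hf : MDiff f) (hg : MDiff g) : MDiff (fun z => f z + g z) := hf.add hg

theorem mdiff_mul (hf : MDiff f) (hg : MDiff g) : MDiff (fun z => f z * g z) := hf.mul hg

theorem mdiff_const_mul (c : ℂ) (hf : MDiff f) : MDiff (fun z => c * f z) := hf.const_smul c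

theorem mdiff_serre (hf : MDiff f) : MDiff (serreDerivative k f) :=
  serreDerivative_mdifferentiable k hf

end Leibniz

/-! ### The modular differential equation and the raising operator -/

/-- The third-order modular differential equation of weight `w - 2` with exponents
`0`, `1`, `w / 4 - 1` at `i∞`, in terms of Serre derivatives. -/
def SolvesSerreODE (w : ℂ) (f : ℍ → ℂ) : Prop :=
  ∀ z, serreDerivative (w + 2) (serreDerivative w (serreDerivative (w - 2) f)) z =
    (3 * w ^ 2 - 36 * w + 140) / 144 * E4 z * serreDerivative (w - 2) f z
      + (w - 2) * (w - 5) * (w - 14) / 864 * E6 z * f z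

/-- The scalar in `raiseOp`. -/
def raiseFactor (w : ℂ) : ℂ := -3 / (10 * (w + 2) * (w - 3) * (w - 5) * (w - 10))

/-- The operator taking a solution of the equation with parameter `w` to a solution of the equation
with parameter `w + 4`. It annihilates the leading term of exponent `w / 4 - 1`. -/
def raiseOp (w : ℂ) (f : ℍ → ℂ) (z : ℍ) : ℂ :=
  raiseFactor w * (serreDerivative w (serreDerivative (w - 2) f) z
    + -((w - 5) * (w - 6) / 36) * (E4 z * f z))

section RaiseOp

variable {w : ℂ} {f g : ℍ → ℂ}

theorem mdiff_raiseOp (hf : MDiff f) : MDiff (raiseOp w f) :=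
  mdiff_const_mul _ (mdiff_add (mdiff_serre (mdiff_serre hf))
    (mdiff_const_mul _ (mdiff_mul MDiff_E4 hf)))

/-- The equation replaces ϑ³f by terms in ϑf and f. The result has no ϑ²f, and both coefficients
share the factor (w+2)(w-10). -/
theorem serre_raiseOp (hf : MDiff f) (h : SolvesSerreODE w f) :
    serreDerivative (w + 2) (raiseOp w f) = fun z =>
      raiseFactor w * ((w + 2) * (w - 10) / 864) *
        (-6 * (E4 z * serreDerivative (w - 2) f z) + (w - 5) * (E6 z * f z)) := by
  ext z
  unfold raiseOp
  rw [serre_const_mul _ (mdiff_add (mdiff_serre (mdiff_serre hf))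
      (mdiff_const_mul _ (mdiff_mul MDiff_E4 hf))),
    serre_add (mdiff_serre (mdiff_serre hf)) (mdiff_const_mul _ (mdiff_mul MDiff_E4 hf)),
    serre_const_mul _ (mdiff_mul MDiff_E4 hf), serre_E4_mul (l := w - 2) hf (by ring), h z]
  ring

theorem serre_serre_raiseOp (hf : MDiff f) (h : SolvesSerreODE w f) :
    serreDerivative (w + 4) (serreDerivative (w + 2) (raiseOp w f)) = fun z =>
      raiseFactor w * ((w + 2) * (w - 10) / 864) *
        (-6 * (E4 z * serreDerivative w (serreDerivative (w - 2) f) z)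
          + ((w - 3) * (E6 z * serreDerivative (w - 2) f z)
          + -((w - 5) / 2) * (E4 z * (E4 z * f z)))) := by
  have h1 := mdiff_mul MDiff_E4 (mdiff_serre (k := w - 2) hf)
  have h2 := mdiff_mul MDiff_E6 hf
  ext z
  rw [serre_raiseOp hf h, serre_const_mul _ (mdiff_add (mdiff_const_mul _ h1)
      (mdiff_const_mul _ h2)), serre_add (mdiff_const_mul _ h1) (mdiff_const_mul _ h2),
    serre_const_mul _ h1, serre_const_mul _ h2, serre_E4_mul (l := w) (mdiff_serre hf) (by ring),
    serre_E6_mul (l := w - 2) hf (by ring)]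
  ring

/-- All derivatives involved reduce to combinations of f, ϑf, ϑ²f over ℂ[E₄, E₆], and the
coefficients agree identically in w. -/
theorem solvesSerreODE_raiseOp (hf : MDiff f) (h : SolvesSerreODE w f) :
    SolvesSerreODE (w + 4) (raiseOp w f) := by
  intro z
  have h1 := mdiff_mul MDiff_E4 (mdiff_serre (k := w) (mdiff_serre (k := w - 2) hf))
  have h2 := mdiff_mul MDiff_E6 (mdiff_serre (k := w - 2) hf)
  have h3 := mdiff_mul MDiff_E4 (mdiff_mul MDiff_E4 hf)
  rw [show w + 4 - 2 = w + 2 by ring, serre_serre_raiseOp hf h,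
    serre_const_mul _ (mdiff_add (mdiff_const_mul _ h1)
      (mdiff_add (mdiff_const_mul _ h2) (mdiff_const_mul _ h3))),
    serre_add (mdiff_const_mul _ h1) (mdiff_add (mdiff_const_mul _ h2) (mdiff_const_mul _ h3)),
    serre_add (mdiff_const_mul _ h2) (mdiff_const_mul _ h3),
    serre_const_mul _ h1, serre_const_mul _ h2, serre_const_mul _ h3,
    serre_E4_mul (l := w + 2) (mdiff_serre (mdiff_serre hf)) (by ring),
    serre_E6_mul (l := w) (mdiff_serre hf) (by ring),
    serre_E4_mul (l := w + 2) (mdiff_mul MDiff_E4 hf) (by ring),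
    serre_E4_mul (l := w - 2) hf (by ring), h z, serre_raiseOp hf h]
  unfold raiseOp
  ring

/-- The inverse of `raiseOp`, up to the factor `Δ`. -/
theorem Del_mul_eq_raiseOp (hf : MDiff f) (h : SolvesSerreODE w f) (z : ℍ) :
    E4 z * serreDerivative (w + 4) (serreDerivative (w + 2) (raiseOp w f)) z
      + (w - 3) / 6 * E6 z * serreDerivative (w + 2) (raiseOp w f) z
      + (w + 2) * (w - 10) / 144 * E4 z ^ 2 * raiseOp w f z =
    -raiseFactor w * ((w + 2) * (w - 3) * (w - 5) * (w - 10) / 3) * (Del z * f z) := by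
  rw [serre_serre_raiseOp hf h, serre_raiseOp hf h, Del_eq]
  unfold raiseOp
  ring

/-- The normalisation in `raiseFactor` makes the scalar 1/10 for every w; this keeps the coefficient
of Δ in the recurrence simple. -/
theorem Del_mul_eq_raiseOp' (hf : MDiff f) (h : SolvesSerreODE w f)
    (hw : (w + 2) * (w - 3) * (w - 5) * (w - 10) ≠ 0) (z : ℍ) :
    Del z * f z = 10 * (E4 z * serreDerivative (w + 4) (serreDerivative (w + 2) (raiseOp w f)) z
      + (w - 3) / 6 * E6 z * serreDerivative (w + 2) (raiseOp w f) z
      + (w + 2) * (w - 10) / 144 * E4 z ^ 2 * raiseOp w f z) := by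
  rw [Del_mul_eq_raiseOp hf h]
  have : raiseFactor w * ((w + 2) * (w - 3) * (w - 5) * (w - 10)) = -3 / 10 := by
    have h10 : 10 * (w + 2) * (w - 3) * (w - 5) * (w - 10) ≠ 0 := by
      simpa [mul_assoc] using hw
    rw [raiseFactor, div_mul_eq_mul_div, div_eq_iff h10]
    ring
  linear_combination (10 / 3 * (Del z * f z)) * this

/-- Expand the three Serre derivatives and eliminate E₆ and E₂'' by Ramanujan's identities. -/
theorem SolvesSerreODE.solvesODE (hf : MDiff f) (h : SolvesSerreODE w f) : SolvesODE w f := by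
  have hD : ∀ {g : ℍ → ℂ}, MDiff g → MDiff (dq g) := normalizedDerivOfComplex_mdifferentiable
  have e1 : serreDerivative (w - 2) f = fun z => dq f z + -((w - 2) / 12) * (E2 z * f z) := by
    ext z; rw [serre_apply]; ring
  have m1 := mdiff_mul MDiff_E2 hf
  have m2 := mdiff_mul (hD MDiff_E2) hf
  have m3 := mdiff_mul MDiff_E2 (hD hf)
  have m4 := mdiff_mul MDiff_E2 m1
  have e2 : serreDerivative w (serreDerivative (w - 2) f) = fun z =>
      dq (dq f) z + (-((w - 2) / 12) * (dq E2 z * f z) + (-((2 * w - 2) / 12) * (E2 z * dq f z)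
        + w * (w - 2) / 144 * (E2 z * (E2 z * f z)))) := by
    ext z
    rw [serre_apply, e1, dq_add (hD hf) (mdiff_const_mul _ m1), dq_const_mul _ m1,
      dq_mul MDiff_E2 hf]
    ring
  intro z
  have h1 := h z
  rw [serre_apply, e2, e1] at h1
  rw [dq_add (hD (hD hf)) (mdiff_add (mdiff_const_mul _ m2) (mdiff_add (mdiff_const_mul _ m3)
      (mdiff_const_mul _ m4))),
    dq_add (mdiff_const_mul _ m2) (mdiff_add (mdiff_const_mul _ m3) (mdiff_const_mul _ m4)),
    dq_add (mdiff_const_mul _ m3) (mdiff_const_mul _ m4),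
    dq_const_mul _ m2, dq_const_mul _ m3, dq_const_mul _ m4,
    dq_mul (hD MDiff_E2) hf, dq_mul MDiff_E2 (hD hf), dq_mul MDiff_E2 m1, dq_mul MDiff_E2 hf] at h1
  have hE2 : dq (dq E2) z = (2 * E2 z * dq E2 z - dq E4 z) / 12 := by
    have : dq E2 = fun z => 1 / 12 * (E2 z * E2 z + -1 * E4 z) := by
      ext z; rw [dq_E2]; ring
    conv_lhs => rw [this]
    rw [dq_const_mul _ (mdiff_add (mdiff_mul MDiff_E2 MDiff_E2) (mdiff_const_mul _ MDiff_E4)),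
      dq_add (mdiff_mul MDiff_E2 MDiff_E2) (mdiff_const_mul _ MDiff_E4),
      dq_mul MDiff_E2 MDiff_E2, dq_const_mul _ MDiff_E4]
    ring
  beta_reduce at h1
  rw [hE2, dq_E4, dq_E2] at h1 ⊢
  linear_combination h1

/-- Three consecutive applications of `raiseOp` satisfy a linear recurrence. -/
theorem raiseOp_recurrence (hf : MDiff f) (h : SolvesSerreODE (w - 8) f)
    (hg : g = raiseOp (w - 8) f) {g' : ℍ → ℂ} (hg' : g' = raiseOp (w - 4) g)
    (h2 : w + 2 ≠ 0) (h3 : w - 3 ≠ 0) (h5 : w - 5 ≠ 0) (h10 : w - 10 ≠ 0)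
    (h2' : w - 2 ≠ 0) (h7 : w - 7 ≠ 0) (h9 : w - 9 ≠ 0) (h14 : w - 14 ≠ 0)
    (h6 : w - 6 ≠ 0) (h11 : w - 11 ≠ 0) (h13 : w - 13 ≠ 0) (h18 : w - 18 ≠ 0) (z : ℍ) :
    raiseOp w g' z =
    1 / (16000 * (w + 2) * (w - 3) * (w - 5) * (w - 9) * (w - 10) * (w - 11)) *
      (200 * (w - 8) * (w - 9) * (w ^ 2 - 15 * w + 38) * E4 z * g' z
        - 5 / 8 * (w - 8) * (w - 12) * E4 z ^ 2 * g z + Del z * f z) := by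
  have hgm : MDiff g := hg ▸ mdiff_raiseOp hf
  have hgs : SolvesSerreODE (w - 4) g := by
    have := solvesSerreODE_raiseOp hf h
    rw [← hg] at this
    convert this using 1
    ring
  -- Everything is expressed through the middle function g: Δf by the inverse operator, ϑ²g' by the
  -- equation for g. A rational identity in w, E₄, E₆, g, ϑg, ϑ²g remains.
  have hdel := Del_mul_eq_raiseOp' hf h (by
    refine mul_ne_zero (mul_ne_zero (mul_ne_zero ?_ ?_) ?_) ?_
    · convert h6 using 1; ring
    · convert h11 using 1; ring
    · convert h13 using 1; ring
    · convert h18 using 1; ring) z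
  have hss := congrFun (serre_serre_raiseOp hgm hgs) z
  rw [← hg, show w - 8 + 4 = w - 4 by ring, show w - 8 + 2 = w - 4 - 2 by ring] at hdel
  rw [← hg', show w - 4 + 4 = w by ring, show w - 4 + 2 = w - 2 by ring] at hss
  rw [hdel, raiseOp, hss, hg', raiseOp]
  simp only [raiseFactor]
  rw [show w - 4 + 2 = w - 2 by ring, show w - 4 - 3 = w - 7 by ring,
    show w - 4 - 5 = w - 9 by ring, show w - 4 - 10 = w - 14 by ring]
  generalize serreDerivative (w - 4) (serreDerivative (w - 4 - 2) g) z = G2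
  generalize serreDerivative (w - 4 - 2) g z = G1
  generalize g z = G0
  generalize E4 z = x
  generalize E6 z = y
  field_simp
  ring

end RaiseOp

/-! ### The initial elements -/

/-- The function `f` is holomorphic, and its normalized derivative is the second argument. -/
def HasDq (f f' : ℍ → ℂ) : Prop := MDiff f ∧ ∀ z, dq f z = f' z

namespace HasDq

variable {f g f' g' : ℍ → ℂ}

theorem add (hf : HasDq f f') (hg : HasDq g g') :
    HasDq (fun z => f z + g z) (fun z => f' z + g' z) :=
  ⟨mdiff_add hf.1 hg.1, fun z => by rw [dq_add hf.1 hg.1, hf.2, hg.2]⟩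

theorem mul (hf : HasDq f f') (hg : HasDq g g') :
    HasDq (fun z => f z * g z) (fun z => f' z * g z + f z * g' z) :=
  ⟨mdiff_mul hf.1 hg.1, fun z => by rw [dq_mul hf.1 hg.1, hf.2, hg.2]⟩

theorem const_mul (c : ℂ) (hf : HasDq f f') : HasDq (fun z => c * f z) (fun z => c * f' z) :=
  ⟨mdiff_const_mul c hf.1, fun z => by rw [dq_const_mul c hf.1, hf.2]⟩

theorem congr (hf : HasDq f f') (hfg : ∀ z, g z = f z) (hfg' : ∀ z, g' z = f' z) : HasDq g g' := by
  obtain rfl : g = f := funext hfg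
  obtain rfl : g' = f' := funext hfg'
  exact hf

theorem _root_.QuasimodularRecurrence.hasDq_E2 : HasDq E2 (fun z => (E2 z ^ 2 - E4 z) / 12) := ⟨MDiff_E2, dq_E2⟩

theorem _root_.QuasimodularRecurrence.hasDq_E4 : HasDq E4 (fun z => (E2 z * E4 z - E6 z) / 3) := ⟨MDiff_E4, dq_E4⟩

theorem _root_.QuasimodularRecurrence.hasDq_E6 : HasDq E6 (fun z => (E2 z * E6 z - E4 z ^ 2) / 2) := ⟨MDiff_E6, dq_E6⟩

theorem dq_eq (hf : HasDq f f') : dq f = f' := funext hf.2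

/-- The derivative of a polynomial of degree at most two in `E₂`. -/
theorem quadratic {A B C A' B' C' : ℍ → ℂ} (hA : HasDq A A') (hB : HasDq B B') (hC : HasDq C C') :
    HasDq (fun z => A z + E2 z * B z
        + E2 z ^ 2 * C z) (fun z => A' z
      + (E2 z ^ 2 - E4 z) / 12 * B z
      + E2 z * B' z
      + E2 z * (E2 z ^ 2
          - E4 z) / 6 * C z
      + E2 z ^ 2 * C' z) :=
  ((hA.add (hasDq_E2.mul hB)).add ((hasDq_E2.mul hasDq_E2).mul hC)).congr (fun z => by ring) (fun z => by ring)

end HasDq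

theorem hasDq_E4_sq : HasDq (E4 ^ 2) (fun z => 2 / 3 * (E2 z * E4 z ^ 2 - E4 z * E6 z)) :=
  (hasDq_E4.mul hasDq_E4).congr (fun z => by simp only [Pi.pow_apply]; ring) (fun z => by ring)

theorem hasDq_E4_mul_E6 : HasDq (fun z => E4 z * E6 z)
    (fun z => 5 / 6 * (E2 z * E4 z * E6 z) - E6 z ^ 2 / 3 - E4 z ^ 3 / 2) :=
  (hasDq_E4.mul hasDq_E6).congr (fun z => rfl) (fun z => by ring)

theorem hasDq_E4_cube : HasDq (fun z => E4 z ^ 3) (fun z => E2 z * E4 z ^ 3 - E4 z ^ 2 * E6 z) :=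
  (hasDq_E4.mul hasDq_E4_sq).congr (fun z => by simp only [Pi.pow_apply]; ring)
    (fun z => by simp only [Pi.pow_apply]; ring)

theorem hasDq_E6_sq : HasDq (fun z => E6 z ^ 2) (fun z => E2 z * E6 z ^ 2 - E4 z ^ 2 * E6 z) :=
  (hasDq_E6.mul hasDq_E6).congr (fun z => by ring) (fun z => by ring)

theorem hasDq_E4_sq_mul_E6 : HasDq (fun z => E4 z ^ 2 * E6 z)
    (fun z => 7 / 6 * (E2 z * E4 z ^ 2 * E6 z) - 2 / 3 * (E4 z * E6 z ^ 2) - E4 z ^ 4 / 2) :=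
  (hasDq_E4_sq.mul hasDq_E6).congr (fun z => rfl) (fun z => by simp only [Pi.pow_apply]; ring)

theorem dq_dq_E4 (z : ℍ) :
    36 / 5 * dq (dq E4) z = E4 z ^ 2 - 2 * E2 z * E6 z + E2 z ^ 2 * E4 z := by
  rw [hasDq_E4.dq_eq, (((hasDq_E2.mul hasDq_E4).add (hasDq_E6.const_mul (-1))).const_mul
    (1 / 3) |>.congr (g := fun z => (E2 z * E4 z - E6 z) / 3) (fun z => by ring)
    (fun z => rfl)).dq_eq]
  ring

theorem dq_dq_E4_sq (z : ℍ) :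
    1 / 3000 * dq (dq (E4 ^ 2)) z - 4 / 25 * Del z =
      1 / 6000 * (E6 z ^ 2 - 2 * E2 z * E4 z * E6 z + E2 z ^ 2 * E4 z ^ 2) := by
  rw [hasDq_E4_sq.dq_eq, (((hasDq_E2.mul hasDq_E4_sq).add
    (hasDq_E4_mul_E6.const_mul (-1))).const_mul (2 / 3) |>.congr
    (g := fun z => 2 / 3 * (E2 z * E4 z ^ 2 - E4 z * E6 z))
    (fun z => by simp only [Pi.pow_apply]; ring) (fun z => rfl)).dq_eq, Del_eq]
  simp only [Pi.pow_apply]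
  ring

theorem dq_dq_weight_twelve (z : ℍ) :
    1 / 2751840000 * dq (dq ((49 : ℂ) • E4 ^ 3 - (25 : ℂ) • E6 ^ 2)) z
      - 1 / 45500 * (Del z * E4 z) =
    1 / 2540160000 * (-25 * E4 z ^ 4 + 49 * E4 z * E6 z ^ 2 - 48 * E2 z * E4 z ^ 2 * E6 z
      + E2 z ^ 2 * (49 * E4 z ^ 3 - 25 * E6 z ^ 2)) := by
  have h1 : HasDq ((49 : ℂ) • E4 ^ 3 - (25 : ℂ) • E6 ^ 2) (fun z =>
      49 * (E2 z * E4 z ^ 3) + -25 * (E2 z * E6 z ^ 2) + -24 * (E4 z ^ 2 * E6 z)) :=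
    ((hasDq_E4_cube.const_mul 49).add (hasDq_E6_sq.const_mul (-25))).congr
      (fun z => by simp; ring) (fun z => by ring)
  rw [h1.dq_eq, ((((hasDq_E2.mul hasDq_E4_cube).const_mul 49).add
    ((hasDq_E2.mul hasDq_E6_sq).const_mul (-25))).add
      (hasDq_E4_sq_mul_E6.const_mul (-24))).dq_eq, Del_eq]
  ring

/-- The first element of the sequence. -/
def f8 (z : ℍ) : ℂ := E4 z ^ 2 - 2 * E2 z * E6 z + E2 z ^ 2 * E4 z

theorem hasDq_f8 : HasDq f8 (fun z => -(1 / 2) * (E4 z * E6 z) + 3 / 2 * (E2 z * E4 z ^ 2)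
      - 3 / 2 * (E2 z ^ 2 * E6 z) + 1 / 2 * (E2 z ^ 3 * E4 z)) :=
  (HasDq.quadratic hasDq_E4_sq (hasDq_E6.const_mul (-2)) hasDq_E4).congr
    (fun z => by simp only [f8, Pi.pow_apply]; ring) (fun z => by ring)

theorem serre_f8 : serreDerivative 6 f8 = fun z =>
    -(1 / 2) * (E4 z * E6 z) + E2 z * E4 z ^ 2 + E2 z ^ 2 * (-(1 / 2) * E6 z) := by
  ext z
  rw [serre_apply, hasDq_f8.dq_eq, f8]
  ring

theorem serre_serre_f8 : serreDerivative 8 (serreDerivative 6 f8) = fun z =>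
    1 / 6 * (E4 z ^ 3 + E6 z ^ 2) + E2 z * (-(2 / 3) * (E4 z * E6 z))
      + E2 z ^ 2 * (1 / 3 * E4 z ^ 2) := by
  have h := HasDq.quadratic (hasDq_E4_mul_E6.const_mul (-(1 / 2))) hasDq_E4_sq
    (hasDq_E6.const_mul (-(1 / 2)))
  simp only [Pi.pow_apply] at h
  ext z
  rw [serre_apply, serre_f8, h.dq_eq]
  ring

theorem solvesSerreODE_f8 : SolvesSerreODE 8 f8 := by
  have h := HasDq.quadratic ((hasDq_E4_cube.add hasDq_E6_sq).const_mul (1 / 6))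
    (hasDq_E4_mul_E6.const_mul (-(2 / 3))) (hasDq_E4_sq.const_mul (1 / 3))
  simp only [Pi.pow_apply] at h
  intro z
  rw [show (8 : ℂ) - 2 = 6 by norm_num, serre_serre_f8, serre_apply, h.dq_eq, serre_f8, f8]
  ring

theorem raiseOp_f8 (z : ℍ) : raiseOp 8 f8 z =
    1 / 6000 * (E6 z ^ 2 - 2 * E2 z * E4 z * E6 z + E2 z ^ 2 * E4 z ^ 2) := by
  rw [raiseOp, show (8 : ℂ) - 2 = 6 by norm_num, serre_serre_f8, raiseFactor, f8]
  ring

/-- The second Serre derivative of the raised function comes from `serre_serre_raiseOp`, so only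
derivatives of f₈ enter. -/
theorem raiseOp_raiseOp_f8 (z : ℍ) : raiseOp 12 (raiseOp 8 f8) z =
    1 / 2540160000 * (-25 * E4 z ^ 4 + 49 * E4 z * E6 z ^ 2 - 48 * E2 z * E4 z ^ 2 * E6 z
      + E2 z ^ 2 * (49 * E4 z ^ 3 - 25 * E6 z ^ 2)) := by
  have h := congrFun (serre_serre_raiseOp hasDq_f8.1 solvesSerreODE_f8) z
  rw [show (8 : ℂ) + 4 = 12 by norm_num, show (8 : ℂ) + 2 = 10 by norm_num,
    show (8 : ℂ) - 2 = 6 by norm_num, serre_serre_f8, serre_f8, f8] at h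
  rw [raiseOp, show (12 : ℂ) - 2 = 10 by norm_num, h, raiseOp_f8, raiseFactor, raiseFactor]
  ring

/-! ### The recurrence sequence as iterated raising -/

section Sequence

variable {f : ℕ → ℍ → ℂ}

/-- The denominators contain only factors w - a with 4 ∤ a, apart from w + 2, so none vanishes for w
divisible by 4. -/
theorem cast_sub_ne_zero {w : ℕ} (hw : 4 ∣ w) {a : ℕ} (ha : a % 4 ≠ 0) : (w : ℂ) - a ≠ 0 := by
  rw [sub_ne_zero]
  intro h
  have : w = a := by exact_mod_cast h
  omega

/-- The elements of the sequence solve their differential equations, and each arises from the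
preceding one by `raiseOp`. -/
theorem IsRecurrenceSequence.raiseOp_eq (hf : IsRecurrenceSequence f) (u : ℕ) :
    MDiff (f (4 * u + 8)) ∧ SolvesSerreODE ((4 * u + 8 : ℕ) : ℂ) (f (4 * u + 8)) ∧
      f (4 * u + 12) = raiseOp ((4 * u + 8 : ℕ) : ℂ) (f (4 * u + 8)) := by
  have h8 : f 8 = f8 := funext hf.init8
  have h12 : f 12 = raiseOp 8 f8 := funext fun z => (hf.init12 z).trans (raiseOp_f8 z).symm
  have h16 : f 16 = raiseOp 12 (raiseOp 8 f8) :=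
    funext fun z => (hf.init16 z).trans (raiseOp_raiseOp_f8 z).symm
  have hnext : ∀ u : ℕ, (MDiff (f (4 * u + 8)) ∧
      SolvesSerreODE ((4 * u + 8 : ℕ) : ℂ) (f (4 * u + 8)) ∧
      f (4 * u + 12) = raiseOp ((4 * u + 8 : ℕ) : ℂ) (f (4 * u + 8))) →
      MDiff (f (4 * u + 12)) ∧ SolvesSerreODE ((4 * u + 12 : ℕ) : ℂ) (f (4 * u + 12)) := by
    rintro u ⟨h1, h2, h3⟩
    refine ⟨h3 ▸ mdiff_raiseOp h1, ?_⟩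
    have := solvesSerreODE_raiseOp h1 h2
    rw [← h3] at this
    convert this using 1
    push_cast
    ring
  induction u using Nat.twoStepInduction with
  | zero =>
    simp only [mul_zero, zero_add, h8, h12]
    exact ⟨hasDq_f8.1, by exact_mod_cast solvesSerreODE_f8, by norm_num⟩
  | one =>
    simp only [mul_one, Nat.reduceAdd, h12, h16]
    exact ⟨mdiff_raiseOp hasDq_f8.1, by
      have := solvesSerreODE_raiseOp hasDq_f8.1 solvesSerreODE_f8
      norm_num at this ⊢
      exact this, by norm_num⟩
  | more u ih0 ih1 =>
    have h2 := hnext (u + 1) ih1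
    refine ⟨h2.1, h2.2, funext fun z => ?_⟩
    have hdvd : 4 ∣ 4 * (u + 2) + 8 := by omega
    have hrec := hf.recurrence (4 * (u + 2) + 8) (by omega) hdvd z
    have ew8 : 4 * (u + 2) + 8 - 8 = 4 * u + 8 := by omega
    have ew4 : 4 * (u + 2) + 8 - 4 = 4 * u + 12 := by omega
    rw [ew8, ew4] at hrec
    have c8 : ((4 * u + 8 : ℕ) : ℂ) = ((4 * (u + 2) + 8 : ℕ) : ℂ) - 8 := by push_cast; ring
    have c4 : ((4 * (u + 1) + 8 : ℕ) : ℂ) = ((4 * (u + 2) + 8 : ℕ) : ℂ) - 4 := by push_cast; ring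
    obtain ⟨a1, a2, a3⟩ := ih0
    obtain ⟨-, -, b3⟩ := ih1
    rw [c8] at a2 a3
    rw [c4] at b3
    refine hrec.trans (raiseOp_recurrence a1 a2 a3 b3 ?_ ?_ ?_ ?_ ?_ ?_ ?_ ?_ ?_ ?_ ?_ ?_ z).symm
    · exact_mod_cast (by omega : 4 * (u + 2) + 8 + 2 ≠ 0)
    all_goals exact_mod_cast cast_sub_ne_zero hdvd (by norm_num)

end Sequence

/-! ### The order of f_w at i∞ -/

theorem HasLeadingCoeff.normalizedDeriv_of_sub_const {f : ℍ → ℂ} {a c : ℂ} {m : ℕ}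
    (h : HasLeadingCoeff (fun z => f z - a) m c) : HasLeadingCoeff (dq f) m (m * c) := by
  refine h.normalizedDeriv.congr (fun z => ?_) rfl
  have h2 := dq_add h.mdiff (HasLeadingCoeff.const a).mdiff z
  simp only [sub_add_cancel] at h2
  have h3 : dq (fun _ => a) z = 0 := congrFun (normalizedDerivOfComplex_const a) z
  rw [h3, add_zero] at h2
  exact h2

/-- The coefficients of `q` in `E₂`, `E₄` and `E₆`. -/
theorem hasLeadingCoeff_sub_one : HasLeadingCoeff (fun z => E2 z - 1) 1 (-24) ∧
    HasLeadingCoeff (fun z => E4 z - 1) 1 240 ∧ HasLeadingCoeff (fun z => E6 z - 1) 1 (-504) := by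
  have hr : ∀ {f : ℍ → ℂ}, HasLeadingCoeff f 0 1 → ∃ e, HasLeadingCoeff (fun z => f z - 1) 1 e :=
    fun hf => ((hf.sub (HasLeadingCoeff.const 1)).congr (d := 0) (fun _ => rfl) (by ring)).raise
  obtain ⟨a, ha⟩ := hr hasLeadingCoeff_E2
  obtain ⟨b, hb⟩ := hr hasLeadingCoeff_E4
  obtain ⟨c, hc⟩ := hr hasLeadingCoeff_E6
  -- Comparing coefficients of q in the identities for E₂', E₄' and 1728Δ = E₄³ - E₆² gives three
  -- linear equations that determine a, b, c.
  have h2 : 12 * (1 * a) = 2 * a - b := by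
    have h1 := ha.normalizedDeriv_of_sub_const.const_mul 12
    have h2 : HasLeadingCoeff (fun z => (E2 z - 1) * E2 z + (E2 z - 1) - (E4 z - 1)) 1
        (a * 1 + a - b) := ((ha.mul hasLeadingCoeff_E2).add ha).sub hb
    have := h1.unique (h2.congr (fun z => by rw [dq_E2]; ring) rfl)
    push_cast at this
    linear_combination this
  have h4 : 3 * (1 * b) = a + b - c := by
    have h1 := hb.normalizedDeriv_of_sub_const.const_mul 3
    have h2 : HasLeadingCoeff (fun z => (E2 z - 1) * E4 z + (E4 z - 1) - (E6 z - 1)) 1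
        (a * 1 + b - c) := ((ha.mul hasLeadingCoeff_E4).add hb).sub hc
    have := h1.unique (h2.congr (fun z => by rw [dq_E4]; ring) rfl)
    push_cast at this
    linear_combination this
  have h6 : 1728 = 3 * b - 2 * c := by
    have h1 := hasLeadingCoeff_Del.const_mul 1728
    have h2 := (hb.mul (((hasLeadingCoeff_E4.pow_zero_order 2).add hasLeadingCoeff_E4).add
      (HasLeadingCoeff.const 1))).sub (hc.mul (hasLeadingCoeff_E6.add (HasLeadingCoeff.const 1)))
    have := h1.unique (h2.congr (fun z => by rw [Del_eq]; ring) rfl)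
    linear_combination this
  have ea : a = -24 := by linear_combination (1 / 72) * h6 + (7 / 72) * h2 - (1 / 36) * h4
  have eb : b = 240 := by linear_combination -10 * ea + h2
  have ec : c = -504 := by linear_combination ea - 2 * eb + h4
  exact ⟨ea ▸ ha, eb ▸ hb, ec ▸ hc⟩

theorem hasLeadingCoeff_f8 : HasLeadingCoeff f8 1 1728 := by
  have h := hasLeadingCoeff_sub_one.2.1.normalizedDeriv_of_sub_const.normalizedDeriv.const_mul
    (36 / 5)
  exact h.congr (fun z => (dq_dq_E4 z).symm) (by norm_num)

variable {f : ℕ → ℍ → ℂ}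

theorem IsRecurrenceSequence.hasLeadingCoeff (hf : IsRecurrenceSequence f) (u : ℕ) :
    ∃ c, c ≠ 0 ∧ HasLeadingCoeff (f (4 * u + 8)) (u + 1) c := by
  induction u with
  | zero =>
    exact ⟨1728, by norm_num, hasLeadingCoeff_f8.congr hf.init8 rfl⟩
  | succ u ih =>
    obtain ⟨c, hc, h⟩ := ih
    obtain ⟨h1, h2, h3⟩ := hf.raiseOp_eq u
    have hdvd : 4 ∣ 4 * u + 8 := by omega
    -- With w = 4u + 8, the exponent r = u + 1 = w/4 - 1 is a root of the indicial polynomial (r -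
    -- w/12)(r - (w-2)/12) - (w-5)(w-6)/36 of `raiseOp w`.
    have hr : HasLeadingCoeff (f (4 * u + 12)) (u + 1) 0 := by
      rw [h3]
      refine ((((h.serreDerivative _).serreDerivative _).add
        ((hasLeadingCoeff_E4.mul h).const_mul _ |>.congr (fun _ => rfl) rfl)).const_mul _).congr
          (fun _ => rfl) ?_
      push_cast
      ring
    obtain ⟨d, hd⟩ := hr.raise
    refine ⟨d, ?_, hd⟩
    rintro rfl
    apply hc
    rw [h3] at hd
    have hne : ((4 * u + 8 : ℕ) + 2 : ℂ) * ((4 * u + 8 : ℕ) - 3) * ((4 * u + 8 : ℕ) - 5)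
        * ((4 * u + 8 : ℕ) - 10) ≠ 0 := by
      refine mul_ne_zero (mul_ne_zero (mul_ne_zero ?_ ?_) ?_) ?_
      · exact_mod_cast (by omega : 4 * u + 8 + 2 ≠ 0)
      all_goals exact_mod_cast cast_sub_ne_zero hdvd (by norm_num)
    -- If the next coefficient vanished too, the inverse operator would make the coefficient c of
    -- q^{u+2} in Δf vanish.
    have hdel := Del_mul_eq_raiseOp' h1 h2 hne
    have e1 := hasLeadingCoeff_Del.mul h
    have := e1.unique (((((hasLeadingCoeff_E4.mul ((hd.serreDerivative _).serreDerivative _)).add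
      ((hasLeadingCoeff_E6.const_mul _).mul (hd.serreDerivative _))).add
      (((hasLeadingCoeff_E4.pow_zero_order 2).const_mul _).mul hd)).const_mul 10).congr
        (n := 1 + (u + 1)) hdel rfl)
    simpa using this

/-! ### The recurrence for the coefficients of powers of E₂ -/

/-- The denominator in the recurrence. -/
def recDenom (w : ℂ) : ℂ :=
  16000 * (w + 2) * (w - 3) * (w - 5) * (w - 9) * (w - 10) * (w - 11)

/-- The coefficient of `E₄ f_w` in the recurrence. -/
def recCoeffE4 (w : ℂ) : ℂ := 200 * (w - 8) * (w - 9) * (w ^ 2 - 15 * w + 38) / recDenom w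

/-- The coefficient of `-E₄² f_{w-4}` in the recurrence. -/
def recCoeffE4Sq (w : ℂ) : ℂ := 5 / 8 * (w - 8) * (w - 12) / recDenom w

/-- The recurrence for sequences indexed by `u = (w - 8) / 4`. -/
def SatisfiesRecurrence (x : ℕ → ℍ → ℂ) : Prop :=
  ∀ u z, x (u + 3) z = recCoeffE4 (4 * u + 16) * (E4 z * x (u + 2) z)
    - recCoeffE4Sq (4 * u + 16) * (E4 z ^ 2 * x (u + 1) z)
    + 1 / recDenom (4 * u + 16) * (Del z * x u z)

/-- The solution of the recurrence with given initial elements. -/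
def recSeq (x0 x1 x2 : ℍ → ℂ) : ℕ → ℍ → ℂ
  | 0 => x0
  | 1 => x1
  | 2 => x2
  | u + 3 => fun z => recCoeffE4 (4 * u + 16) * (E4 z * recSeq x0 x1 x2 (u + 2) z)
    - recCoeffE4Sq (4 * u + 16) * (E4 z ^ 2 * recSeq x0 x1 x2 (u + 1) z)
    + 1 / recDenom (4 * u + 16) * (Del z * recSeq x0 x1 x2 u z)

theorem satisfiesRecurrence_recSeq (x0 x1 x2 : ℍ → ℂ) :
    SatisfiesRecurrence (recSeq x0 x1 x2) := fun u z => by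
  rw [recSeq]

theorem IsRecurrenceSequence.satisfiesRecurrence {f : ℕ → ℍ → ℂ} (hf : IsRecurrenceSequence f) :
    SatisfiesRecurrence (fun u => f (4 * u + 8)) := fun u z => by
  have h := hf.recurrence (4 * u + 16) (by omega) (by omega) z
  rw [show 4 * u + 16 + 4 = 4 * (u + 3) + 8 by ring,
    show 4 * u + 16 - 4 = 4 * (u + 1) + 8 by omega,
    show 4 * u + 16 - 8 = 4 * u + 8 by omega] at h
  have h2 : f (4 * u + 16) z = f (4 * (u + 2) + 8) z := congrFun (congrArg f (by ring)) z
  beta_reduce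
  rw [h, h2, recCoeffE4, recCoeffE4Sq, recDenom]
  push_cast
  ring

namespace SatisfiesRecurrence

variable {x y : ℕ → ℍ → ℂ}

/-- The recurrence is pointwise in z, so the multiplier may be any function of z, in particular E₂.
-/
theorem sub_mul (hx : SatisfiesRecurrence x) (hy : SatisfiesRecurrence y) (a : ℍ → ℂ) :
    SatisfiesRecurrence (fun u z => x u z - a z * y u z) := fun u z => by
  simp only [hx u z, hy u z]
  ring

theorem ext (hx : SatisfiesRecurrence x) (hy : SatisfiesRecurrence y) (h0 : ∀ z, x 0 z = y 0 z)
    (h1 : ∀ z, x 1 z = y 1 z) (h2 : ∀ z, x 2 z = y 2 z) (u : ℕ) (z : ℍ) : x u z = y u z := by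
  have : ∀ u, x u z = y u z ∧ x (u + 1) z = y (u + 1) z ∧ x (u + 2) z = y (u + 2) z := by
    intro u
    induction u with
    | zero => exact ⟨h0 z, h1 z, h2 z⟩
    | succ u ih =>
      refine ⟨ih.2.1, ih.2.2, ?_⟩
      rw [show u + 1 + 2 = u + 3 by ring, hx u z, hy u z, ih.1, ih.2.1, ih.2.2]
  exact (this u).1

theorem isModular (hx : SatisfiesRecurrence x) {k : ℤ} (h0 : IsModular k (x 0))
    (h1 : IsModular (k + 4) (x 1)) (h2 : IsModular (k + 8) (x 2)) (u : ℕ) :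
    IsModular (k + 4 * u) (x u) := by
  have : ∀ u : ℕ, IsModular (k + 4 * u) (x u) ∧ IsModular (k + 4 * u + 4) (x (u + 1)) ∧
      IsModular (k + 4 * u + 8) (x (u + 2)) := by
    intro u
    induction u with
    | zero => simpa using ⟨h0, h1, h2⟩
    | succ u ih =>
      obtain ⟨i0, i1, i2⟩ := ih
      refine ⟨i1.congr (by push_cast; ring) fun _ => rfl,
        i2.congr (by push_cast; ring) fun _ => rfl, ?_⟩
      refine (((((IsModular.E4.mul i2).congr (l := k + 4 * u + 12) (by ring) fun _ => rfl).const_mul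
        (recCoeffE4 (4 * u + 16))).sub
        ((((IsModular.E4.mul IsModular.E4).mul i1).congr (l := k + 4 * u + 12) (by ring)
          fun _ => rfl).const_mul (recCoeffE4Sq (4 * u + 16)))).add
        (((IsModular.Del.mul i0).congr (l := k + 4 * u + 12) (by ring)
          fun _ => rfl).const_mul (1 / recDenom (4 * u + 16)))).congr (by push_cast; ring)
          fun z => ?_
      rw [show u + 1 + 2 = u + 3 by ring, hx u z]
      ring
  exact (this u).1

/-- The term with Δ has order at least m + 1 and drops out; E₄ contributes its constant term 1. -/
theorem hasLeadingCoeff (hx : SatisfiesRecurrence x) {m : ℕ} {t : ℕ → ℂ}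
    (ht : ∀ u : ℕ, t (u + 3) = recCoeffE4 (4 * u + 16) * t (u + 2)
      - recCoeffE4Sq (4 * u + 16) * t (u + 1))
    (h0 : HasLeadingCoeff (x 0) m (t 0)) (h1 : HasLeadingCoeff (x 1) m (t 1))
    (h2 : HasLeadingCoeff (x 2) m (t 2)) (u : ℕ) : HasLeadingCoeff (x u) m (t u) := by
  have : ∀ u, HasLeadingCoeff (x u) m (t u) ∧ HasLeadingCoeff (x (u + 1)) m (t (u + 1)) ∧
      HasLeadingCoeff (x (u + 2)) m (t (u + 2)) := by
    intro u
    induction u with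
    | zero => exact ⟨h0, h1, h2⟩
    | succ u ih =>
      obtain ⟨i0, i1, i2⟩ := ih
      refine ⟨i1, i2, ?_⟩
      refine (((((hasLeadingCoeff_E4.mul i2).congr (n := m) (fun _ => rfl) rfl).const_mul
        (recCoeffE4 (4 * u + 16))).sub
        ((((hasLeadingCoeff_E4.pow_zero_order 2).mul i1).congr (n := m)
          (fun _ => rfl) rfl).const_mul (recCoeffE4Sq (4 * u + 16)))).add
        (((hasLeadingCoeff_Del.mul i0).congr (n := m + 1) (fun _ => rfl) rfl).lower.const_mul
          (1 / recDenom (4 * u + 16)))).congr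
          (fun z => hx u z) ?_
      rw [show u + 1 + 2 = u + 3 by ring, ht u]
      ring
  exact (this u).1

end SatisfiesRecurrence

theorem cast_four_mul_add_sub_ne_zero (u : ℕ) {a b : ℕ} (h : a % 4 ≠ b % 4) :
    (4 * (u : ℂ) + a) - b ≠ 0 := by
  rw [sub_ne_zero]
  intro h'
  have : 4 * u + a = b := by exact_mod_cast h'
  omega

/-- The ratio of consecutive constant terms. -/
def constRatio (w : ℂ) : ℂ := (w - 4) / (160 * (w + 2) * (w - 3) * (w - 5))

/-- The ratio of consecutive coefficients of `q`. -/
def linRatio (w : ℂ) : ℂ := (w - 8) / (160 * (w - 3) * (w - 5) * (w - 10))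

/-- The constant terms of the forms `h_w`, `w = 4u + 8`. -/
def constSeq : ℕ → ℂ
  | 0 => 1
  | u + 1 => constRatio (4 * u + 8) * constSeq u

/-- The coefficients of `q` of the forms `g_w`, `w = 4u + 8`. -/
def linSeq : ℕ → ℂ
  | 0 => -720
  -- A second initial value, -720/6000, is needed because `linRatio 8 = 0`.
  | 1 => -3 / 25
  | u + 2 => linRatio (4 * u + 12) * linSeq (u + 1)

section Ratios

variable (u : ℕ)

/-- A sequence with these consecutive ratios solves the shortened recurrence. The ratios `constRatio
w` and `linRatio w` are the factors by which `raiseOp w` multiplies leading terms of exponent 0 and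
1. -/
theorem constRatio_mul :
    constRatio (4 * u + 16) * constRatio (4 * u + 12) =
      recCoeffE4 (4 * u + 16) * constRatio (4 * u + 12) - recCoeffE4Sq (4 * u + 16) := by
  have h2 : (4 * u + 16 : ℂ) + 2 ≠ 0 := by exact_mod_cast (by omega : 4 * u + 16 + 2 ≠ 0)
  have h2' : (4 * u + 16 : ℂ) - 2 ≠ 0 := cast_four_mul_add_sub_ne_zero u (by norm_num)
  have h3 : (4 * u + 16 : ℂ) - 3 ≠ 0 := cast_four_mul_add_sub_ne_zero u (by norm_num)
  have h5 : (4 * u + 16 : ℂ) - 5 ≠ 0 := cast_four_mul_add_sub_ne_zero u (by norm_num)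
  have h7 : (4 * u + 16 : ℂ) - 7 ≠ 0 := cast_four_mul_add_sub_ne_zero u (by norm_num)
  have h9 : (4 * u + 16 : ℂ) - 9 ≠ 0 := cast_four_mul_add_sub_ne_zero u (by norm_num)
  have h10 : (4 * u + 16 : ℂ) - 10 ≠ 0 := cast_four_mul_add_sub_ne_zero u (by norm_num)
  have h11 : (4 * u + 16 : ℂ) - 11 ≠ 0 := cast_four_mul_add_sub_ne_zero u (by norm_num)
  rw [show (4 * u + 12 : ℂ) = (4 * u + 16) - 4 by ring]
  generalize (4 * u + 16 : ℂ) = w at *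
  simp only [constRatio, recCoeffE4, recCoeffE4Sq, recDenom]
  rw [show w - 4 + 2 = w - 2 by ring, show w - 4 - 3 = w - 7 by ring,
    show w - 4 - 5 = w - 9 by ring]
  field_simp
  ring

theorem linRatio_mul :
    linRatio (4 * u + 16) * linRatio (4 * u + 12) =
      recCoeffE4 (4 * u + 16) * linRatio (4 * u + 12) - recCoeffE4Sq (4 * u + 16) := by
  have h2 : (4 * u + 16 : ℂ) + 2 ≠ 0 := by exact_mod_cast (by omega : 4 * u + 16 + 2 ≠ 0)
  have h3 : (4 * u + 16 : ℂ) - 3 ≠ 0 := cast_four_mul_add_sub_ne_zero u (by norm_num)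
  have h5 : (4 * u + 16 : ℂ) - 5 ≠ 0 := cast_four_mul_add_sub_ne_zero u (by norm_num)
  have h7 : (4 * u + 16 : ℂ) - 7 ≠ 0 := cast_four_mul_add_sub_ne_zero u (by norm_num)
  have h9 : (4 * u + 16 : ℂ) - 9 ≠ 0 := cast_four_mul_add_sub_ne_zero u (by norm_num)
  have h10 : (4 * u + 16 : ℂ) - 10 ≠ 0 := cast_four_mul_add_sub_ne_zero u (by norm_num)
  have h11 : (4 * u + 16 : ℂ) - 11 ≠ 0 := cast_four_mul_add_sub_ne_zero u (by norm_num)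
  have h14 : (4 * u + 16 : ℂ) - 14 ≠ 0 := cast_four_mul_add_sub_ne_zero u (by norm_num)
  rw [show (4 * u + 12 : ℂ) = (4 * u + 16) - 4 by ring]
  generalize (4 * u + 16 : ℂ) = w at *
  simp only [linRatio, recCoeffE4, recCoeffE4Sq, recDenom]
  rw [show w - 4 - 10 = w - 14 by ring, show w - 4 - 3 = w - 7 by ring,
    show w - 4 - 5 = w - 9 by ring, show w - 4 - 8 = w - 12 by ring]
  field_simp
  ring

theorem constSeq_recurrence :
    constSeq (u + 3) = recCoeffE4 (4 * u + 16) * constSeq (u + 2)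
      - recCoeffE4Sq (4 * u + 16) * constSeq (u + 1) := by
  have h := constRatio_mul u
  have e1 : constSeq (u + 3) = constRatio (4 * u + 16) * constSeq (u + 2) := by
    rw [constSeq]; push_cast; ring_nf
  have e2 : constSeq (u + 2) = constRatio (4 * u + 12) * constSeq (u + 1) := by
    rw [constSeq]; push_cast; ring_nf
  rw [e1, e2]
  linear_combination constSeq (u + 1) * h

theorem linSeq_recurrence :
    linSeq (u + 3) = recCoeffE4 (4 * u + 16) * linSeq (u + 2)
      - recCoeffE4Sq (4 * u + 16) * linSeq (u + 1) := by
  have h := linRatio_mul u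
  have e1 : linSeq (u + 3) = linRatio (4 * u + 16) * linSeq (u + 2) := by
    rw [linSeq]; push_cast; ring_nf
  have e2 : linSeq (u + 2) = linRatio (4 * u + 12) * linSeq (u + 1) := by
    rw [linSeq]
  rw [e1, e2]
  linear_combination linSeq (u + 1) * h

theorem constSeq_ne_zero : constSeq u ≠ 0 := by
  induction u with
  | zero => simp [constSeq]
  | succ u ih =>
    rw [constSeq]
    refine mul_ne_zero (div_ne_zero ?_ (mul_ne_zero (mul_ne_zero (mul_ne_zero (by norm_num) ?_)
      ?_) ?_)) ih
    · rw [show (4 * u + 8 - 4 : ℂ) = 4 * u + 4 by ring]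
      exact_mod_cast (by omega : 4 * u + 4 ≠ 0)
    · exact_mod_cast (by omega : 4 * u + 8 + 2 ≠ 0)
    all_goals exact cast_four_mul_add_sub_ne_zero u (by norm_num)

theorem linSeq_ne_zero : linSeq u ≠ 0 := by
  induction u using Nat.twoStepInduction with
  | zero => simp [linSeq]
  | one => norm_num [linSeq]
  | more u _ ih =>
    rw [linSeq]
    refine mul_ne_zero (div_ne_zero ?_ (mul_ne_zero (mul_ne_zero (mul_ne_zero (by norm_num) ?_)
      ?_) ?_)) ih
    · rw [show (4 * u + 12 - 8 : ℂ) = 4 * u + 4 by ring]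
      exact_mod_cast (by omega : 4 * u + 4 ≠ 0)
    all_goals exact cast_four_mul_add_sub_ne_zero u (by norm_num)

end Ratios

/-- The part of `f_w` of degree `0` in `E₂`, `w = 4u + 8`. -/
def coeffA : ℕ → ℍ → ℂ := recSeq (fun z => E4 z ^ 2) (fun z => 1 / 6000 * E6 z ^ 2)
  (fun z => 1 / 2540160000 * (-25 * E4 z ^ 4 + 49 * E4 z * E6 z ^ 2))

/-- The coefficient of `-2 E₂` in `f_w`, `w = 4u + 8`. -/
def coeffB : ℕ → ℍ → ℂ := recSeq (fun z => E6 z) (fun z => 1 / 6000 * (E4 z * E6 z))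
  (fun z => 24 / 2540160000 * (E4 z ^ 2 * E6 z))

/-- The coefficient of `E₂²` in `f_w`, `w = 4u + 8`. -/
def coeffC : ℕ → ℍ → ℂ := recSeq (fun z => E4 z) (fun z => 1 / 6000 * E4 z ^ 2)
  (fun z => 1 / 2540160000 * (49 * E4 z ^ 3 - 25 * E6 z ^ 2))

theorem satisfiesRecurrence_coeffA : SatisfiesRecurrence coeffA := satisfiesRecurrence_recSeq _ _ _
theorem satisfiesRecurrence_coeffB : SatisfiesRecurrence coeffB := satisfiesRecurrence_recSeq _ _ _
theorem satisfiesRecurrence_coeffC : SatisfiesRecurrence coeffC := satisfiesRecurrence_recSeq _ _ _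

/-- Both sides satisfy the recurrence and agree at the first three indices. The double sign lets
`sub_mul` serve for E₂² as well. -/
theorem IsRecurrenceSequence.eq_coeff {f : ℕ → ℍ → ℂ} (hf : IsRecurrenceSequence f) (u : ℕ)
    (z : ℍ) : f (4 * u + 8) z =
      coeffA u z - 2 * E2 z * coeffB u z - -E2 z ^ 2 * coeffC u z := by
  refine hf.satisfiesRecurrence.ext ((satisfiesRecurrence_coeffA.sub_mul satisfiesRecurrence_coeffB
    (fun z => 2 * E2 z)).sub_mul satisfiesRecurrence_coeffC (fun z => -E2 z ^ 2))
    (fun z => ?_) (fun z => ?_) (fun z => ?_) u z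
  · exact (hf.init8 z).trans (by simp only [coeffA, coeffB, coeffC, recSeq]; ring)
  · exact (hf.init12 z).trans (by simp only [coeffA, coeffB, coeffC, recSeq]; ring)
  · exact (hf.init16 z).trans (by simp only [coeffA, coeffB, coeffC, recSeq]; ring)

theorem constSeq_one : constSeq 1 = 1 / 6000 := by
  norm_num [constSeq, constRatio]

theorem constSeq_two : constSeq 2 = 24 / 2540160000 := by
  norm_num [constSeq, constRatio]

theorem hasLeadingCoeff_coeffC (u : ℕ) : HasLeadingCoeff (coeffC u) 0 (constSeq u) := by
  refine satisfiesRecurrence_coeffC.hasLeadingCoeff constSeq_recurrence hasLeadingCoeff_E4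
    (((hasLeadingCoeff_E4.pow_zero_order 2).const_mul (1 / 6000)).congr (fun _ => rfl) ?_)
    (((((hasLeadingCoeff_E4.pow_zero_order 3).const_mul 49).sub
      ((hasLeadingCoeff_E6.pow_zero_order 2).const_mul 25)).const_mul (1 / 2540160000)).congr
        (fun _ => rfl) ?_) u
  · rw [constSeq_one]; norm_num
  · rw [constSeq_two]; norm_num

/-- This combination is g_w. It satisfies the recurrence, and its first three elements already
vanish at i∞. -/
theorem hasLeadingCoeff_coeffB_sub (u : ℕ) :
    HasLeadingCoeff (fun z => coeffB u z - E2 z * coeffC u z) 1 (linSeq u) := by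
  obtain ⟨h2, h4, h6⟩ := hasLeadingCoeff_sub_one
  have h : HasLeadingCoeff (fun z => E6 z - E2 z * E4 z) 1 (-720) :=
    ((h6.sub (h2.mul hasLeadingCoeff_E4)).sub h4).congr (fun z => by ring) (by norm_num)
  refine (satisfiesRecurrence_coeffB.sub_mul satisfiesRecurrence_coeffC E2).hasLeadingCoeff
    linSeq_recurrence (h.congr (fun _ => rfl) rfl)
    (((hasLeadingCoeff_E4.mul h).const_mul (1 / 6000)).congr (fun z => ?_) ?_) ?_ u
  · simp only [coeffB, coeffC, recSeq]; ring
  · norm_num [linSeq]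
  -- 24E₄²E₆ - E₂(49E₄³ - 25E₆²) = 24E₄²(E₆ - E₂E₄) - 25 · 1728 E₂Δ.
  · have h' := ((((hasLeadingCoeff_E4.pow_zero_order 2).mul h).const_mul 24).sub
      ((hasLeadingCoeff_E2.mul hasLeadingCoeff_Del).const_mul (25 * 1728))).const_mul
        (1 / 2540160000)
    refine h'.congr (fun z => ?_) ?_
    · simp only [coeffB, coeffC, recSeq, Del_eq]; ring
    · norm_num [linSeq, linRatio]

theorem isModular_coeffA (u : ℕ) : IsModular (8 + 4 * u) (coeffA u) := by
  have h4 := IsModular.E4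
  have h6 := IsModular.E6
  refine satisfiesRecurrence_coeffA.isModular
    ((h4.mul h4).congr (by norm_num) fun z => ?_)
    (((h6.mul h6).const_mul (1 / 6000)).congr (by norm_num) fun z => ?_)
    (((((h4.mul h4).mul (h4.mul h4)).const_mul (-25)).add
      (((h4.mul (h6.mul h6)).const_mul 49).congr (by norm_num) fun _ => rfl)
      |>.const_mul (1 / 2540160000)).congr (by norm_num) fun z => ?_) u
  all_goals simp only [coeffA, recSeq]; ring

theorem isModular_coeffB (u : ℕ) : IsModular (6 + 4 * u) (coeffB u) := by
  have h4 := IsModular.E4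
  have h6 := IsModular.E6
  refine satisfiesRecurrence_coeffB.isModular h6
    (((h4.mul h6).const_mul (1 / 6000)).congr (by norm_num) fun z => ?_)
    ((((h4.mul h4).mul h6).const_mul (24 / 2540160000)).congr (by norm_num) fun z => ?_) u
  · simp only [coeffB, recSeq]
  · simp only [coeffB, recSeq]; ring

theorem isModular_coeffC (u : ℕ) : IsModular (4 + 4 * u) (coeffC u) := by
  have h4 := IsModular.E4
  have h6 := IsModular.E6
  refine satisfiesRecurrence_coeffC.isModular h4
    (((h4.mul h4).const_mul (1 / 6000)).congr (by norm_num) fun z => ?_)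
    (((((h4.mul h4).mul h4).const_mul 49).sub
      (((h6.mul h6).const_mul 25).congr (by norm_num) fun _ => rfl)
      |>.const_mul (1 / 2540160000)).congr (by norm_num) fun z => ?_) u
  all_goals simp only [coeffC, recSeq]; ring

/-! ### The coefficients as polynomials in j -/

theorem Del_ne_zero (z : ℍ) : Del z ≠ 0 := ModularForm.discriminant_ne_zero z

/-- `F = Δⁿ ω_m P(j)` with a polynomial `P` of degree at most `d` whose coefficient of `Xᵈ`
is `c`. -/
def HasPolyForm (n m d : ℕ) (c : ℂ) (F : ℍ → ℂ) : Prop :=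
  ∃ P : ℂ[X], P.natDegree ≤ d ∧ P.coeff d = c ∧
    ∀ z, F z = Del z ^ n * (omega m z * P.eval (klein z))

open Polynomial in
-- Multiplying the prefactors by E₄ or E₄² gives the new prefactor times a power jᵉ that brings the
-- degree up to d. The Δ term has lower degree, so it does not affect the leading coefficient.
theorem HasPolyForm.recurrence {n m d n₂ m₂ d₂ e₂ n₁ m₁ d₁ e₁ n₀ m₀ d₀ : ℕ} {c₂ c₁ c₀ a b r c : ℂ}
    {F₂ F₁ F₀ F : ℍ → ℂ} (h₂ : HasPolyForm n₂ m₂ d₂ c₂ F₂) (h₁ : HasPolyForm n₁ m₁ d₁ c₁ F₁)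
    (h₀ : HasPolyForm n₀ m₀ d₀ c₀ F₀)
    (hF : ∀ z, F z = a * (E4 z * F₂ z) - b * (E4 z ^ 2 * F₁ z) + r * (Del z * F₀ z))
    (hc : c = a * c₂ - b * c₁)
    (hd₂ : d = d₂ + e₂) (hd₁ : d = d₁ + e₁) (hd₀ : d₀ < d)
    (k₂ : ∀ z, E4 z * (Del z ^ n₂ * omega m₂ z) = Del z ^ n * omega m z * klein z ^ e₂)
    (k₁ : ∀ z, E4 z ^ 2 * (Del z ^ n₁ * omega m₁ z) = Del z ^ n * omega m z * klein z ^ e₁)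
    (k₀ : ∀ z, Del z * (Del z ^ n₀ * omega m₀ z) = Del z ^ n * omega m z) :
    HasPolyForm n m d c F := by
  obtain ⟨P₂, p₂, q₂, r₂⟩ := h₂
  obtain ⟨P₁, p₁, q₁, r₁⟩ := h₁
  obtain ⟨P₀, p₀, q₀, r₀⟩ := h₀
  refine ⟨C a * (P₂ * X ^ e₂) - C b * (P₁ * X ^ e₁) + C r * P₀, ?_, ?_, fun z => ?_⟩
  · refine natDegree_add_le_of_degree_le ((natDegree_sub_le _ _).trans (max_le
      ((natDegree_C_mul_le _ _).trans ?_) ((natDegree_C_mul_le _ _).trans ?_)))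
      ((natDegree_C_mul_le _ _).trans (p₀.trans hd₀.le))
    · exact (natDegree_mul_le_of_le p₂ (natDegree_X_pow_le _)).trans hd₂.ge
    · exact (natDegree_mul_le_of_le p₁ (natDegree_X_pow_le _)).trans hd₁.ge
  · have e2 : (P₂ * X ^ e₂).coeff d = c₂ := by rw [hd₂, coeff_mul_X_pow, q₂]
    have e1 : (P₁ * X ^ e₁).coeff d = c₁ := by rw [hd₁, coeff_mul_X_pow, q₁]
    have e0 : P₀.coeff d = 0 := coeff_eq_zero_of_natDegree_lt (p₀.trans_lt hd₀)
    simp only [coeff_add, coeff_sub, coeff_C_mul, e2, e1, e0, hc]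
    ring
  · simp only [eval_add, eval_sub, eval_mul, eval_C, eval_pow, eval_X]
    rw [hF, r₂, r₁, r₀]
    linear_combination (a * P₂.eval (klein z)) * k₂ z - (b * P₁.eval (klein z)) * k₁ z
      + (r * P₀.eval (klein z)) * k₀ z

theorem constSeq_succ_three (u : ℕ) {v w x : ℕ} (hv : v = u + 3) (hw : w = u + 2) (hx : x = u + 1) :
    constSeq v = recCoeffE4 (4 * u + 16) * constSeq w - recCoeffE4Sq (4 * u + 16) * constSeq x := by
  subst hv hw hx
  exact constSeq_recurrence u

open Polynomial in
-- The indices 3n, 3n+1, 3n+2 belong to k = 2, 4, 0. In the last case w = 12(n+1) + 4, whence the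
-- exponent n + 1 of Δ.
theorem hasPolyForm_coeffA (n : ℕ) :
    HasPolyForm n 4 n (constSeq (3 * n)) (coeffA (3 * n)) ∧
    HasPolyForm n 6 (n + 1) (constSeq (3 * n + 1)) (coeffA (3 * n + 1)) ∧
    HasPolyForm (n + 1) 2 (n + 1) (constSeq (3 * n + 2)) (coeffA (3 * n + 2)) := by
  induction n with
  | zero =>
    -- The linear polynomials come from E₆² = Δ(j - 1728).
    refine ⟨⟨1, by simp, by simp [constSeq], fun z => ?_⟩,
      ⟨C (1 / 6000) * X + C (-1728 / 6000), natDegree_linear_le, ?_, fun z => ?_⟩,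
      ⟨C (24 / 2540160000) * X + C (-49 * 1728 / 2540160000), natDegree_linear_le, ?_, fun z => ?_⟩⟩
    · simp [coeffA, recSeq, omega]
    · simp [constSeq_one]
    · have := Del_ne_zero z
      have hd := Del_eq z
      simp only [coeffA, recSeq, omega, klein, eval_add, eval_mul, eval_C, eval_X]
      field_simp
      linear_combination 1728 * hd
    · simp [constSeq_two]
    · have := Del_ne_zero z
      have hd := Del_eq z
      simp only [coeffA, recSeq, omega, klein, eval_add, eval_mul, eval_C, eval_X]
      field_simp
      linear_combination 49 * 1728 * E4 z * Del z * hd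
  | succ n ih =>
    obtain ⟨i0, i1, i2⟩ := ih
    have hrec := satisfiesRecurrence_coeffA
    have j0 : HasPolyForm (n + 1) 4 (n + 1) (constSeq (3 * (n + 1))) (coeffA (3 * (n + 1))) := by
      refine HasPolyForm.recurrence (e₂ := 0) (e₁ := 0) i2 i1 i0 (hrec (3 * n))
        (constSeq_succ_three _ rfl rfl rfl) (by omega) (by omega) (by omega)
        (fun z => ?_) (fun z => ?_) (fun z => ?_) <;>
      · have := Del_ne_zero z
        simp only [omega, klein, Pi.pow_apply]
        first | (field_simp; done) | (field_simp; ring)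
    have j1 : HasPolyForm (n + 1) 6 (n + 1 + 1) (constSeq (3 * (n + 1) + 1))
        (coeffA (3 * (n + 1) + 1)) := by
      refine HasPolyForm.recurrence (e₂ := 1) (e₁ := 1) j0 i2 i1 (hrec (3 * n + 1))
        (constSeq_succ_three _ rfl rfl rfl) (by omega) (by omega) (by omega)
        (fun z => ?_) (fun z => ?_) (fun z => ?_) <;>
      · have := Del_ne_zero z
        simp only [omega, klein, Pi.pow_apply]
        first | (field_simp; done) | (field_simp; ring)
    refine ⟨j0, j1, ?_⟩
    refine HasPolyForm.recurrence (e₂ := 0) (e₁ := 1) j1 j0 i2 (hrec (3 * n + 2))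
      (constSeq_succ_three _ rfl rfl rfl) (by omega) (by omega) (by omega)
      (fun z => ?_) (fun z => ?_) (fun z => ?_) <;>
    · have := Del_ne_zero z
      simp only [omega, klein, Pi.pow_apply]
      first | (field_simp; done) | (field_simp; ring)

open Polynomial in
theorem hasPolyForm_coeffB (n : ℕ) :
    HasPolyForm n 3 n (constSeq (3 * n)) (coeffB (3 * n)) ∧
    HasPolyForm n 5 n (constSeq (3 * n + 1)) (coeffB (3 * n + 1)) ∧
    HasPolyForm (n + 1) 1 n (constSeq (3 * n + 2)) (coeffB (3 * n + 2)) := by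
  induction n with
  | zero =>
    refine ⟨⟨1, by simp, by simp [constSeq], fun z => ?_⟩,
      ⟨C (1 / 6000), by simp, by simp [constSeq_one], fun z => ?_⟩,
      ⟨C (24 / 2540160000), by simp, by simp [constSeq_two], fun z => ?_⟩⟩
    · simp [coeffB, recSeq, omega]
    · simp only [coeffB, recSeq, omega, Pi.mul_apply, eval_C]
      ring
    · have := Del_ne_zero z
      simp only [coeffB, recSeq, omega, Pi.mul_apply, Pi.div_apply, Pi.pow_apply, eval_C]
      field_simp
      ring
  | succ n ih =>
    obtain ⟨i0, i1, i2⟩ := ih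
    have hrec := satisfiesRecurrence_coeffB
    have j0 : HasPolyForm (n + 1) 3 (n + 1) (constSeq (3 * (n + 1))) (coeffB (3 * (n + 1))) := by
      refine HasPolyForm.recurrence (e₂ := 1) (e₁ := 1) i2 i1 i0 (hrec (3 * n))
        (constSeq_succ_three _ rfl rfl rfl) (by omega) (by omega) (by omega)
        (fun z => ?_) (fun z => ?_) (fun z => ?_) <;>
      · have := Del_ne_zero z
        simp only [omega, klein, Pi.mul_apply, Pi.div_apply, Pi.pow_apply]
        first | (field_simp; done) | (field_simp; ring)
    have j1 : HasPolyForm (n + 1) 5 (n + 1) (constSeq (3 * (n + 1) + 1))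
        (coeffB (3 * (n + 1) + 1)) := by
      refine HasPolyForm.recurrence (e₂ := 0) (e₁ := 1) j0 i2 i1 (hrec (3 * n + 1))
        (constSeq_succ_three _ rfl rfl rfl) (by omega) (by omega) (by omega)
        (fun z => ?_) (fun z => ?_) (fun z => ?_) <;>
      · have := Del_ne_zero z
        simp only [omega, klein, Pi.mul_apply, Pi.div_apply, Pi.pow_apply]
        first | (field_simp; done) | (field_simp; ring)
    refine ⟨j0, j1, ?_⟩
    refine HasPolyForm.recurrence (e₂ := 0) (e₁ := 0) j1 j0 i2 (hrec (3 * n + 2))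
      (constSeq_succ_three _ rfl rfl rfl) (by omega) (by omega) (by omega)
      (fun z => ?_) (fun z => ?_) (fun z => ?_) <;>
    · have := Del_ne_zero z
      simp only [omega, klein, Pi.mul_apply, Pi.div_apply, Pi.pow_apply]
      first | (field_simp; done) | (field_simp; ring)

open Polynomial in
theorem hasPolyForm_coeffC (n : ℕ) :
    HasPolyForm n 2 n (constSeq (3 * n)) (coeffC (3 * n)) ∧
    HasPolyForm n 4 n (constSeq (3 * n + 1)) (coeffC (3 * n + 1)) ∧
    HasPolyForm (n + 1) 0 (n + 1) (constSeq (3 * n + 2)) (coeffC (3 * n + 2)) := by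
  induction n with
  | zero =>
    refine ⟨⟨1, by simp, by simp [constSeq], fun z => ?_⟩,
      ⟨C (1 / 6000), by simp, by simp [constSeq_one], fun z => ?_⟩,
      ⟨C (24 / 2540160000) * X + C (25 * 1728 / 2540160000), natDegree_linear_le, ?_, fun z => ?_⟩⟩
    · simp [coeffC, recSeq, omega]
    · simp only [coeffC, recSeq, omega, Pi.pow_apply, eval_C]
      ring
    · simp [constSeq_two]
    · have := Del_ne_zero z
      have hd := Del_eq z
      simp only [coeffC, recSeq, omega, klein, Pi.one_apply, eval_add, eval_mul, eval_C, eval_X]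
      field_simp
      linear_combination -(25 * 1728 * Del z) * hd
  | succ n ih =>
    obtain ⟨i0, i1, i2⟩ := ih
    have hrec := satisfiesRecurrence_coeffC
    have j0 : HasPolyForm (n + 1) 2 (n + 1) (constSeq (3 * (n + 1))) (coeffC (3 * (n + 1))) := by
      refine HasPolyForm.recurrence (e₂ := 0) (e₁ := 1) i2 i1 i0 (hrec (3 * n))
        (constSeq_succ_three _ rfl rfl rfl) (by omega) (by omega) (by omega)
        (fun z => ?_) (fun z => ?_) (fun z => ?_) <;>
      · have := Del_ne_zero z
        simp only [omega, klein, Pi.pow_apply, Pi.one_apply]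
        first | (field_simp; done) | (field_simp; ring)
    have j1 : HasPolyForm (n + 1) 4 (n + 1) (constSeq (3 * (n + 1) + 1))
        (coeffC (3 * (n + 1) + 1)) := by
      refine HasPolyForm.recurrence (e₂ := 0) (e₁ := 0) j0 i2 i1 (hrec (3 * n + 1))
        (constSeq_succ_three _ rfl rfl rfl) (by omega) (by omega) (by omega)
        (fun z => ?_) (fun z => ?_) (fun z => ?_) <;>
      · have := Del_ne_zero z
        simp only [omega, klein, Pi.pow_apply, Pi.one_apply]
        first | (field_simp; done) | (field_simp; ring)
    refine ⟨j0, j1, ?_⟩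
    refine HasPolyForm.recurrence (e₂ := 1) (e₁ := 1) j1 j0 i2 (hrec (3 * n + 2))
      (constSeq_succ_three _ rfl rfl rfl) (by omega) (by omega) (by omega)
      (fun z => ?_) (fun z => ?_) (fun z => ?_) <;>
    · have := Del_ne_zero z
      simp only [omega, klein, Pi.pow_apply, Pi.one_apply]
      first | (field_simp; done) | (field_simp; ring)

/-! ### Uniqueness of the polynomials -/

/-- `F` transforms like a modular form of weight `k`. -/
def TransformsWithWeight (k : ℤ) (F : ℍ → ℂ) : Prop :=
  ∀ (γ : SL(2, ℤ)) (z : ℍ), F (γ • z) = denom γ z ^ k * F z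

namespace TransformsWithWeight

variable {k l : ℤ} {F G : ℍ → ℂ}

theorem mul (hF : TransformsWithWeight k F) (hG : TransformsWithWeight l G) :
    TransformsWithWeight (k + l) (fun z => F z * G z) := fun γ z => by
  beta_reduce
  rw [hF, hG, zpow_add₀ (denom_ne_zero γ z)]
  ring

theorem div (hF : TransformsWithWeight k F) (hG : TransformsWithWeight l G) :
    TransformsWithWeight (k - l) (fun z => F z / G z) := fun γ z => by
  beta_reduce
  rw [hF, hG, zpow_sub₀ (denom_ne_zero γ z), mul_div_mul_comm]

theorem pow (hF : TransformsWithWeight k F) (n : ℕ) :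
    TransformsWithWeight (k * n) (fun z => F z ^ n) := fun γ z => by
  beta_reduce
  rw [hF, mul_pow, zpow_mul, zpow_natCast]

theorem congr (hF : TransformsWithWeight k F) (hkl : l = k) (hFG : ∀ z, G z = F z) :
    TransformsWithWeight l G := fun γ z => by
  rw [hFG, hFG, hkl, hF]

theorem eval_polynomial (hF : TransformsWithWeight 0 F) (P : ℂ[X]) :
    TransformsWithWeight 0 (fun z => P.eval (F z)) := fun γ z => by
  beta_reduce
  rw [hF]; simp

end TransformsWithWeight

theorem IsModular.transformsWithWeight {k : ℤ} {F : ℍ → ℂ} (hF : IsModular k F) :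
    TransformsWithWeight k F := fun γ z => by
  obtain ⟨G, hG⟩ := hF
  have h := congrFun (slash_ModularForm G γ) z
  rw [ModularForm.SL_slash_apply, zpow_neg, ← div_eq_mul_inv,
    div_eq_iff (zpow_ne_zero _ (denom_ne_zero γ z)), hG, hG] at h
  rw [h, mul_comm]

theorem transformsWithWeight_klein : TransformsWithWeight 0 klein :=
  ((IsModular.E4.transformsWithWeight.pow 3).div IsModular.Del.transformsWithWeight).congr
    (by norm_num) fun _ => rfl

theorem transformsWithWeight_omega {m : ℕ} (hm : m ≤ 7) :
    TransformsWithWeight (2 * m) (omega m) := by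
  have h4 := IsModular.E4.transformsWithWeight
  have h6 := IsModular.E6.transformsWithWeight
  have hD := IsModular.Del.transformsWithWeight
  interval_cases m
  · intro γ z; simp [omega]
  · exact (((h4.pow 2).mul h6).div hD).congr (by norm_num) fun _ => rfl
  · exact h4.congr (by norm_num) fun _ => rfl
  · exact h6.congr (by norm_num) fun _ => rfl
  · exact (h4.pow 2).congr (by norm_num) fun _ => rfl
  · exact (h4.mul h6).congr (by norm_num) fun _ => rfl
  · exact hD.congr (by norm_num) fun _ => rfl
  · exact ((h4.pow 2).mul h6).congr (by norm_num) fun _ => rfl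

theorem E2_smul (γ : SL(2, ℤ)) (z : ℍ) :
    E2 (γ • z) = denom γ z ^ (2 : ℤ) *
      (E2 z + 12 / (2 * Real.pi * Complex.I) * (γ 1 0 / denom γ z)) := by
  have h := E2_slash_apply γ z
  rw [ModularForm.SL_slash_apply, zpow_neg, ← div_eq_mul_inv,
    div_eq_iff (zpow_ne_zero _ (denom_ne_zero γ z))] at h
  rw [h, mul_comm]

/-- `1`, `E₂`, `E₂²` are linearly independent over functions that transform like modular forms of
the appropriate weights. -/
theorem eq_zero_of_quadratic_E2 {k : ℤ} {A B C : ℍ → ℂ} (hA : TransformsWithWeight k A)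
    (hB : TransformsWithWeight (k - 2) B) (hC : TransformsWithWeight (k - 4) C)
    (h : ∀ z, A z - 2 * E2 z * B z + E2 z ^ 2 * C z = 0) (z : ℍ) :
    A z = 0 ∧ B z = 0 ∧ C z = 0 := by
  -- Evaluating at γz and dividing by the automorphy factor replaces E₂ by E₂ plus its anomaly. The
  -- identity, S and ST give three distinct roots of the quadratic polynomial A - 2BX + CX², which
  -- is therefore zero.
  have key : ∀ γ : SL(2, ℤ), A z - 2 * (E2 z + 12 / (2 * Real.pi * Complex.I) *
      (γ 1 0 / denom γ z)) * B z + (E2 z + 12 / (2 * Real.pi * Complex.I) *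
      (γ 1 0 / denom γ z)) ^ 2 * C z = 0 := by
    intro γ
    have h1 := h (γ • z)
    have hd := denom_ne_zero γ z
    rw [hA, hB, hC, E2_smul, zpow_sub₀ hd, zpow_sub₀ hd] at h1
    have hk : denom γ z ^ k ≠ 0 := zpow_ne_zero _ hd
    refine (mul_eq_zero.1 (Eq.trans ?_ h1)).resolve_left hk
    have e2 : denom γ z ^ (2 : ℤ) = denom γ z ^ 2 := zpow_ofNat _ _
    have e4 : denom γ z ^ (4 : ℤ) = denom γ z ^ 4 := zpow_ofNat _ _
    rw [e2, e4]
    generalize 12 / (2 * Real.pi * Complex.I) * (γ 1 0 / denom γ z) = t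
    field_simp
  have hτ : (12 / (2 * Real.pi * Complex.I) : ℂ) ≠ 0 :=
    div_ne_zero (by norm_num) Complex.two_pi_I_ne_zero
  have hz : (z : ℂ) ≠ 0 := z.ne_zero
  have hz1 : (z : ℂ) + 1 ≠ 0 := by
    intro h0
    have := congrArg Complex.im h0
    simp at this
    exact z.im_pos.ne' this
  have hS := key ModularGroup.S
  have hST := key (ModularGroup.S * ModularGroup.T)
  have eS : ((ModularGroup.S 1 0 : ℤ) : ℂ) / denom ModularGroup.S z = 1 / z := by
    rw [ModularGroup.denom_S]
    simp [ModularGroup.S]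
  have eST : (((ModularGroup.S * ModularGroup.T) 1 0 : ℤ) : ℂ) /
      denom (ModularGroup.S * ModularGroup.T : SL(2, ℤ)) z = 1 / (z + 1) := by
    have h0 : (ModularGroup.S * ModularGroup.T : SL(2, ℤ)) 1 0 = 1 := by decide
    have h1 : (ModularGroup.S * ModularGroup.T : SL(2, ℤ)) 1 1 = 1 := by decide
    rw [ModularGroup.denom_apply, h0, h1]
    simp
  rw [eS] at hS
  rw [eST] at hST
  have h1 := h z
  generalize 12 / (2 * Real.pi * Complex.I) = τ at *
  have d1 : τ * (1 / z) ≠ 0 := mul_ne_zero hτ (one_div_ne_zero hz)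
  have d2 : τ * (1 / (z + 1)) ≠ 0 := mul_ne_zero hτ (one_div_ne_zero hz1)
  have d3 : τ * (1 / z) - τ * (1 / (z + 1)) ≠ 0 := by
    have : τ * (1 / z) - τ * (1 / (z + 1)) = τ * (1 / (z * (z + 1))) := by
      field_simp
      ring
    rw [this]
    exact mul_ne_zero hτ (one_div_ne_zero (mul_ne_zero hz hz1))
  generalize τ * (1 / (z : ℂ)) = s at *
  generalize τ * (1 / ((z : ℂ) + 1)) = t at *
  have f1 : -2 * B z + (2 * E2 z + s) * C z = 0 := by
    refine (mul_eq_zero.1 (?_ : s * _ = 0)).resolve_left d1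
    linear_combination hS - h1
  have f2 : -2 * B z + (2 * E2 z + t) * C z = 0 := by
    refine (mul_eq_zero.1 (?_ : t * _ = 0)).resolve_left d2
    linear_combination hST - h1
  have hC0 : C z = 0 := by
    refine (mul_eq_zero.1 (?_ : (s - t) * _ = 0)).resolve_left d3
    linear_combination f1 - f2
  have hB0 : B z = 0 := by
    rw [hC0] at f1
    linear_combination -f1 / 2
  refine ⟨?_, hB0, hC0⟩
  rw [hC0, hB0] at h1
  linear_combination h1

theorem eventually_omega_ne_zero {m : ℕ} (hm : m ≤ 7) : ∀ᶠ z in atImInfty, omega m z ≠ 0 := by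
  filter_upwards [hasLeadingCoeff_E4.tendsto_zero_order.eventually_ne one_ne_zero,
    hasLeadingCoeff_E6.tendsto_zero_order.eventually_ne one_ne_zero] with z h4 h6
  have hD : Del z ≠ 0 := ModularForm.discriminant_ne_zero z
  interval_cases m <;> simp [omega, h4, h6, hD]

/-- E₄³ - rΔ tends to 1 at i∞. -/
theorem eventually_klein_ne (r : ℂ) : ∀ᶠ z in atImInfty, klein z ≠ r := by
  have h : HasLeadingCoeff (fun z => E4 z ^ 3 - r * Del z) 0 (1 ^ 3 - r * 0) :=
    (hasLeadingCoeff_E4.pow_zero_order 3).sub (hasLeadingCoeff_Del.lower.const_mul r)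
  filter_upwards [h.tendsto_zero_order.eventually_ne
    (by norm_num : (1 : ℂ) ^ 3 - r * 0 ≠ 0)] with z hz h0
  have hD : Del z ≠ 0 := ModularForm.discriminant_ne_zero z
  rw [klein, div_eq_iff hD] at h0
  exact hz (by rw [h0, sub_self])

/-- A polynomial in `j` that vanishes identically is zero. -/
theorem eq_zero_of_omega_mul_eval {m : ℕ} (hm : m ≤ 7) {P : ℂ[X]}
    (h : ∀ z, omega m z * P.eval (klein z) = 0) : P = 0 := by
  by_contra hP
  -- Near i∞ the function j avoids the finitely many roots of P, and ω_m has no zeros there.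
  have hroots : ∀ᶠ z in atImInfty, ∀ r ∈ P.roots.toFinset, klein z ≠ r :=
    (Filter.eventually_all_finset _).2 fun r _ => eventually_klein_ne r
  obtain ⟨z, hz, hz'⟩ := (hroots.and (eventually_omega_ne_zero hm)).exists
  refine hz (klein z) ?_ rfl
  rw [Multiset.mem_toFinset, Polynomial.mem_roots hP]
  exact (mul_eq_zero.1 (h z)).resolve_left hz'

theorem fForm_injective {n k : ℕ} (hk : k ≤ 5) {P Q R P' Q' R' : ℂ[X]}
    (h : fForm n k P' Q' R' = fForm n k P Q R) : P' = P ∧ Q' = Q ∧ R' = R := by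
  have ht : ∀ {m : ℕ}, m ≤ 7 → ∀ S : ℂ[X], TransformsWithWeight (12 * n + 2 * m)
      (fun z => Del z ^ n * (omega m z * S.eval (klein z))) := fun hm S =>
    ((IsModular.Del.transformsWithWeight.pow n).mul ((transformsWithWeight_omega hm).mul
      (transformsWithWeight_klein.eval_polynomial S))).congr (by ring) fun _ => rfl
  have hsum : ∀ z, Del z ^ n * (omega (k + 2) z * (P' - P).eval (klein z))
      - 2 * E2 z * (Del z ^ n * (omega (k + 1) z * (Q' - Q).eval (klein z)))
      + E2 z ^ 2 * (Del z ^ n * (omega k z * (R' - R).eval (klein z))) = 0 := fun z => by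
    have := congrFun h z
    simp only [fForm] at this
    simp only [Polynomial.eval_sub]
    linear_combination this
  have hzero := eq_zero_of_quadratic_E2 (ht (by omega) (P' - P))
    ((ht (by omega) (Q' - Q)).congr (by push_cast; ring) fun _ => rfl)
    ((ht (by omega) (R' - R)).congr (by push_cast; ring) fun _ => rfl) hsum
  have hD : ∀ z, Del z ^ n ≠ 0 := fun z => pow_ne_zero _ (ModularForm.discriminant_ne_zero z)
  refine ⟨sub_eq_zero.1 (eq_zero_of_omega_mul_eval (m := k + 2) (by omega) fun z => ?_),
    sub_eq_zero.1 (eq_zero_of_omega_mul_eval (m := k + 1) (by omega) fun z => ?_),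
    sub_eq_zero.1 (eq_zero_of_omega_mul_eval (m := k) (by omega) fun z => ?_)⟩
  · exact (mul_eq_zero.1 (hzero z).1).resolve_left (hD z)
  · exact (mul_eq_zero.1 (hzero z).2.1).resolve_left (hD z)
  · exact (mul_eq_zero.1 (hzero z).2.2).resolve_left (hD z)

/-! ### Assembly -/

theorem natDegree_eq_of_coeff_eq {P : ℂ[X]} {d : ℕ} {c : ℂ} (hP : P.natDegree ≤ d)
    (hc : P.coeff d = c) (h : c ≠ 0) : P.natDegree = d :=
  le_antisymm hP (Polynomial.le_natDegree_of_ne_zero (hc ▸ h))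

namespace IsRecurrenceSequence

variable {f : ℕ → ℍ → ℂ}

theorem isQuasimodular (hf : IsRecurrenceSequence f) (u : ℕ) :
    IsQuasimodular ((4 * u + 8 : ℕ) : ℤ) 2 (f (4 * u + 8)) := by
  obtain ⟨A, hA⟩ := (isModular_coeffA u).congr
    (l := ((4 * u + 8 : ℕ) : ℤ) - 2 * ((0 : ℕ) : ℤ)) (by push_cast; ring) fun _ => rfl
  obtain ⟨B, hB⟩ := ((isModular_coeffB u).const_mul (-2)).congr
    (l := ((4 * u + 8 : ℕ) : ℤ) - 2 * ((1 : ℕ) : ℤ)) (by push_cast; ring) fun _ => rfl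
  obtain ⟨C, hC⟩ := (isModular_coeffC u).congr
    (l := ((4 * u + 8 : ℕ) : ℤ) - 2 * ((2 : ℕ) : ℤ)) (by push_cast; ring) fun _ => rfl
  refine ⟨fun l => match l with
    | 0 => A
    | 1 => B
    | 2 => C
    | _ + 3 => 0, fun h0 => ?_, fun z => ?_⟩
  -- The coefficient of E₂² is nonzero because its constant term is `constSeq u`.
  · have hz : ∀ z, coeffC u z = 0 := fun z => by
      rw [← hC]
      exact congrArg (fun F : ModularForm 𝒮ℒ _ => F z) h0
    have hlim := (hasLeadingCoeff_coeffC u).tendsto_zero_order.congr hz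
    exact constSeq_ne_zero u (tendsto_nhds_unique hlim tendsto_const_nhds)
  · rw [hf.eq_coeff u z]
    simp only [Finset.sum_range_succ, Finset.sum_range_zero, hA, hB, hC]
    ring

theorem exists_fForm (hf : IsRecurrenceSequence f) {u n k dP dQ dR : ℕ} (hk : k ≤ 5)
    (hA : HasPolyForm n (k + 2) dP (constSeq u) (coeffA u))
    (hB : HasPolyForm n (k + 1) dQ (constSeq u) (coeffB u))
    (hC : HasPolyForm n k dR (constSeq u) (coeffC u)) :
    ∃ P Q R : ℂ[X],
      P.natDegree = dP ∧ Q.natDegree = dQ ∧ R.natDegree = dR ∧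
      f (4 * u + 8) = fForm n k P Q R ∧
      (∀ P' Q' R' : ℂ[X], f (4 * u + 8) = fForm n k P' Q' R' → P' = P ∧ Q' = Q ∧ R' = R) ∧
      HasExactOrder (f (4 * u + 8)) (u + 1) ∧
      HasExactOrder (gForm n k Q R) 1 ∧ HasExactOrder (hForm n k R) 0 := by
  obtain ⟨P, dP, cP, eP⟩ := hA
  obtain ⟨Q, dQ, cQ, eQ⟩ := hB
  obtain ⟨R, dR, cR, eR⟩ := hC
  have h0 := constSeq_ne_zero u
  have hform : f (4 * u + 8) = fForm n k P Q R := funext fun z => by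
    rw [hf.eq_coeff u z, eP, eQ, eR, fForm]
    ring
  obtain ⟨c, hc, hlead⟩ := hf.hasLeadingCoeff u
  refine ⟨P, Q, R, natDegree_eq_of_coeff_eq dP cP h0, natDegree_eq_of_coeff_eq dQ cQ h0,
    natDegree_eq_of_coeff_eq dR cR h0, hform,
    fun P' Q' R' h => fForm_injective hk (h.symm.trans hform), hlead.hasExactOrder hc, ?_, ?_⟩
  · refine ((hasLeadingCoeff_coeffB_sub u).congr (fun z => ?_) rfl).hasExactOrder (linSeq_ne_zero u)
    rw [eQ, eR, gForm]
    ring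
  · exact ((hasLeadingCoeff_coeffC u).congr (fun z => (eR z).symm) rfl).hasExactOrder h0

end IsRecurrenceSequence

end

end QuasimodularRecurrence

open QuasimodularRecurrence in
theorem proposition5p1 (f : ℕ → ℍ → ℂ) (hf : IsRecurrenceSequence f) :
    -- the closed forms of the initial elements through derivatives
    (∀ z, f 8 z = 36 / 5 * dq (dq E4) z) ∧
    (∀ z, f 12 z = 1 / 3000 * dq (dq (E4 ^ 2)) z - 4 / 25 * Del z) ∧
    (∀ z, f 16 z = 1 / 2751840000 * dq (dq ((49 : ℂ) • E4 ^ 3 - (25 : ℂ) • E6 ^ 2)) z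
      - 1 / 45500 * (Del z * E4 z)) ∧
    ∀ w n k : ℕ, 8 ≤ w → 4 ∣ w → k ≤ 5 → w = 12 * n + 2 * k + 4 →
      IsQuasimodular (w : ℤ) 2 (f w) ∧
      SolvesODE (w : ℂ) (f w) ∧
      ∃ P Q R : Polynomial ℂ,
        -- `f w` is of the prescribed shape, for exactly one choice of the polynomials
        P.natDegree = degP n k ∧ Q.natDegree = degQ n k ∧ R.natDegree = degR n k ∧
        f w = fForm n k P Q R ∧
        (∀ P' Q' R' : Polynomial ℂ, f w = fForm n k P' Q' R' → P' = P ∧ Q' = Q ∧ R' = R) ∧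
        -- the exact orders of `f w` and of the corresponding `g` and `h`
        HasExactOrder (f w) (w / 4 - 1) ∧
        HasExactOrder (gForm n k Q R) 1 ∧
        HasExactOrder (hForm n k R) 0 := by
  refine ⟨fun z => (hf.init8 z).trans (dq_dq_E4 z).symm,
    fun z => (hf.init12 z).trans (dq_dq_E4_sq z).symm,
    fun z => (hf.init16 z).trans (dq_dq_weight_twelve z).symm, fun w n k hw h4 hk hwnk => ?_⟩
  obtain ⟨u, rfl⟩ : ∃ u, w = 4 * u + 8 := ⟨w / 4 - 2, by omega⟩
  obtain ⟨hmd, hode, -⟩ := hf.raiseOp_eq u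
  refine ⟨hf.isQuasimodular u, hode.solvesODE hmd, ?_⟩
  rw [show (4 * u + 8) / 4 - 1 = u + 1 by omega]
  -- Divisibility of w by 4 forces k to be even.
  obtain rfl | rfl | rfl : k = 2 ∨ k = 4 ∨ k = 0 := by omega
  · obtain rfl : u = 3 * n := by omega
    exact hf.exists_fForm hk (hasPolyForm_coeffA n).1 (hasPolyForm_coeffB n).1
      (hasPolyForm_coeffC n).1
  · obtain rfl : u = 3 * n + 1 := by omega
    exact hf.exists_fForm hk (hasPolyForm_coeffA n).2.1 (hasPolyForm_coeffB n).2.1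
      (hasPolyForm_coeffC n).2.1
  -- For k = 0 the bound w ≥ 8 excludes n = 0, so the degree n - 1 of Q is not truncated.
  · obtain ⟨m, rfl⟩ : ∃ m, n = m + 1 := ⟨n - 1, by omega⟩
    obtain rfl : u = 3 * m + 2 := by omega
    exact hf.exists_fForm hk (hasPolyForm_coeffA m).2.2 (hasPolyForm_coeffB m).2.2
      (hasPolyForm_coeffC m).2.2
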